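/- Let $k$ be a field. Rings and $k$-algebras are associative, possibly without unity element and possibly infinite-dimensional; $r(R)$ denotes the Jacobson radical of a ring $R$ (its largest quasi-regular two-sided ideal). A *gm unit* of an algebra $\Lambda$ is a family $\{e_i\}_{i\in I}$ of non-zero elements, indexed by a non-empty (possibly infinite) set $I$, with $e_ie_j=\delta_{ij}e_i$ for all $i,j\in I$, such that for every $x\in\Lambda$ there is a finite $F\subseteq I$ with $(\sum_{i\in F}e_i)x=x=x(\sum_{i\in F}e_i)$. Let $D$ be a directed graph (possibly infinite, with loops and multiple arrows allowed) with non-empty vertex set $I$, and let $\Omega=(\Omega_i)_{i\in I}$ be a family of $k$-algebras with unity element $e_i\neq 0$ and $r(\Omega_i)=0$. For $i,j\in I$ let $P_{ij}$ be the quotient of the $k$-vector space on all generalized paths $a_{0}x_1a_1x_2\cdots x_na_n$ from $i$ to $j$ (where $n\ge 0$, the $x_p$ are consecutive arrows through vertices $i=i_0,i_1,\dots,i_n=j$, and $a_p\in\Omega_{i_p}$) by the relations saying that a generalized path is $k$-linear in each entry $a_p$; paths of length $0$ give $\Omega_i\subseteq P_{ii}$. The generalized path algebra $k(D,\Omega)=\bigoplus_{i,j\in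 I}P_{ij}$ has the multiplication induced by $$(a_0x_1\cdots x_na_n)(b_0y_1\cdots y_mb_m)=a_0x_1\cdots x_n(a_nb_0)y_1\cdots y_mb_m$$ if the first path ends where the second one starts, the product being $0$ otherwise. Let $J$ be the ideal of $k(D,\Omega)$ generated by all arrows $x=e_ixe_j$. If $\rho$ is a non-empty subset of $k(D,\Omega)$ such that the ideal $(\rho)$ generated by $\rho$ satisfies $J^t\subseteq(\rho)\subseteq J$ for some integer $t\ge 1$, then $k(D,\Omega)/(\rho)$ is called a generalized path algebra with weak relations. **Theorem.** For a $k$-algebra $\Lambda$ the following are equivalent: 1. $\Lambda=A\oplus r(\Lambda)$ as vector spaces for some subalgebra $A$ of $\Lambda$, the ideal $r(\Lambda)$ is nilpotent, and $\Lambda$ has a gm unit $\{e_i\}_{i\in I}$ such that the image of each $e_i$ lies in the center of $\Lambda/r(\Lambda)$; 2. $\Lambda$ is isomorphic, as a $k$-algebra, to a generalized path algebra $k(D,\Omega)/(\rho)$ with weak relations, for some $D$, $\Omega$ and $\rho$ as above. -/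

import Mathlib

open scoped DirectSum

universe u v

/-! ### Rings and algebras that need not have a unity element -/

section NonUnital

variable {R : Type*} [NonUnitalRing R]

/-- A two-sided ideal all of whose elements are quasi-regular. -/
def IsQuasiregularIdeal (I : TwoSidedIdeal R) : Prop :=
  ∀ x ∈ I, IsQuasiregular x

theorem IsQuasiregular.add_of_mem {I : TwoSidedIdeal R} (hI : IsQuasiregularIdeal I) {x y : R}
    (hx : IsQuasiregular x) (hy : y ∈ I) : IsQuasiregular (x + y) := by
  obtain ⟨x', h1, h2⟩ := isQuasiregular_iff.1 hx
  have hz : y + x' * y ∈ I := I.add_mem hy (I.mul_mem_left _ _ hy)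
  have hmul := (isQuasiregular_iff'.1 hx).mul (isQuasiregular_iff'.1 (hI _ hz))
  rw [isQuasiregular_iff']
  convert hmul using 1
  apply PreQuasiregular.equiv.symm.injective
  have h3 : (x' + x + x * x') * y = 0 := by rw [h1, zero_mul]
  simp only [PreQuasiregular.equiv_symm_apply, PreQuasiregular.equiv_apply_val,
    PreQuasiregular.val_mul]
  have h4 : x' * y + x * y + x * (x' * y) = 0 := by
    rw [← h3, add_mul, add_mul, mul_assoc]
  calc x + y = x + y + (x' * y + x * y + x * (x' * y)) := by rw [h4, add_zero]
    _ = y + x' * y + x + x * (y + x' * y) := by rw [mul_add]; abel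

theorem IsQuasiregularIdeal.sup {I J : TwoSidedIdeal R} (hI : IsQuasiregularIdeal I)
    (hJ : IsQuasiregularIdeal J) : IsQuasiregularIdeal (I ⊔ J) := by
  intro z hz
  obtain ⟨x, hx, y, hy, rfl⟩ := TwoSidedIdeal.mem_sup.1 hz
  exact (hI x hx).add_of_mem hJ hy

variable (R) in
/-- The Jacobson radical of a ring that may lack a unity element: the largest quasi-regular
two-sided ideal. -/
def jacobsonRadical : TwoSidedIdeal R :=
  TwoSidedIdeal.mk' {x | ∃ I : TwoSidedIdeal R, IsQuasiregularIdeal I ∧ x ∈ I}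
    ⟨⊥, fun x hx => by
      rw [(TwoSidedIdeal.mem_bot R).1 hx]
      exact isQuasiregular_iff.2 ⟨0, by simp⟩, TwoSidedIdeal.zero_mem _⟩
    (by
      rintro x y ⟨I, hI, hx⟩ ⟨J, hJ, hy⟩
      exact ⟨I ⊔ J, hI.sup hJ, TwoSidedIdeal.mem_sup.2 ⟨x, hx, y, hy, rfl⟩⟩)
    (by
      rintro x ⟨I, hI, hx⟩
      exact ⟨I, hI, I.neg_mem hx⟩)
    (by
      rintro x y ⟨I, hI, hy⟩
      exact ⟨I, hI, I.mul_mem_left _ _ hy⟩)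
    (by
      rintro x y ⟨I, hI, hx⟩
      exact ⟨I, hI, I.mul_mem_right _ _ hx⟩)

theorem isGreatest_jacobsonRadical :
    IsGreatest {I : TwoSidedIdeal R | IsQuasiregularIdeal I} (jacobsonRadical R) := by
  refine ⟨fun x hx => ?_, fun I hI => ?_⟩
  · obtain ⟨I, hI, hxI⟩ := (TwoSidedIdeal.mem_mk' _ _ _ _ _ _ x).1 hx
    exact hI x hxI
  · exact TwoSidedIdeal.le_iff.2 fun x hx =>
      (TwoSidedIdeal.mem_mk' _ _ _ _ _ _ x).2 ⟨I, hI, hx⟩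

/-- `idealPowSucc I n` is the power `I ^ (n + 1)`, i.e. the set of finite sums of products of
`n + 1` elements of `I`. (The zeroth power is not used: the ring may have no unity element.) -/
def idealPowSucc (I : TwoSidedIdeal R) : ℕ → AddSubgroup R
  | 0 => AddSubgroup.closure (I : Set R)
  | n + 1 => AddSubgroup.closure {z | ∃ x ∈ idealPowSucc I n, ∃ y ∈ I, z = x * y}

/-- `I ^ t = 0` for some `t ≥ 1`. -/
def IsNilpotentIdeal (I : TwoSidedIdeal R) : Prop :=
  ∃ n : ℕ, idealPowSucc I n = ⊥

/-- A generalized matrix unit: a complete set of pairwise orthogonal non-zero idempotents,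
indexed by a possibly infinite set. -/
structure IsGMUnit {ι : Type*} (e : ι → R) : Prop where
  idem : ∀ i, e i * e i = e i
  orthogonal : ∀ i j, i ≠ j → e i * e j = 0
  complete : ∀ x : R, ∃ F : Finset ι, (∑ i ∈ F, e i) * x = x ∧ x * (∑ i ∈ F, e i) = x
  ne_zero : ∀ i, e i ≠ 0

/-- `Λ` can be lifted: `Λ = A ⊕ r(Λ)` for some subalgebra `A`. -/
def CanBeLifted (k : Type*) (Λ : Type*) [Field k] [NonUnitalRing Λ] [Module k Λ] : Prop :=
  ∃ A : NonUnitalSubalgebra k Λ,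
    (∀ x ∈ A, x ∈ jacobsonRadical Λ → x = 0) ∧
    ∀ x : Λ, ∃ a ∈ A, ∃ b ∈ jacobsonRadical Λ, x = a + b

end NonUnital

/-! ### Generalized matrix algebras -/

/-- The multiplication of a system of vector spaces `A i j`: bilinear maps
`A i j × A j l → A i l` that are associative wherever this makes sense. -/
class GammaSystem (k : Type*) [Field k] {ι : Type*} (A : ι → ι → Type*)
    [∀ i j, AddCommGroup (A i j)] [∀ i j, Module k (A i j)] where
  mul : ∀ i j l, A i j →ₗ[k] A j l →ₗ[k] A i l
  mul_assoc : ∀ i j l s (x : A i j) (y : A j l) (z : A l s),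
    mul i l s (mul i j l x y) z = mul i j s x (mul j l s y z)

/-- The external direct sum of the `A i j`: "matrices" with finitely many non-zero entries. -/
def GMAlgebra (k : Type*) [Field k] {ι : Type*} (A : ι → ι → Type*)
    [∀ i j, AddCommGroup (A i j)] [∀ i j, Module k (A i j)] : Type _ :=
  ⨁ i, ⨁ j, A i j

namespace GMAlgebra

variable {k : Type*} [Field k] {ι : Type*} {A : ι → ι → Type*}
  [∀ i j, AddCommGroup (A i j)] [∀ i j, Module k (A i j)]

noncomputable instance : AddCommGroup (GMAlgebra k A) :=
  inferInstanceAs (AddCommGroup (⨁ i, ⨁ j, A i j))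

noncomputable instance : Module k (GMAlgebra k A) :=
  inferInstanceAs (Module k (⨁ i, ⨁ j, A i j))

variable (k A) in
/-- The `i`-th row of a matrix. -/
noncomputable def row (i : ι) : GMAlgebra k A →ₗ[k] ⨁ j, A i j :=
  DirectSum.component k ι (fun i => ⨁ j, A i j) i

open scoped Classical in
variable (k A) in
/-- The matrix whose only non-zero row is the `i`-th one. -/
noncomputable def ofRow (i : ι) : (⨁ j, A i j) →ₗ[k] GMAlgebra k A :=
  DirectSum.lof k ι (fun i => ⨁ j, A i j) i

open scoped Classical in
variable (k A) in
/-- The matrix whose only non-zero entry is at `(i, j)`. -/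
noncomputable def single (i j : ι) : A i j →ₗ[k] GMAlgebra k A :=
  ofRow k A i ∘ₗ DirectSum.lof k ι (fun j => A i j) j

theorem row_ofRow_same (i : ι) (v : ⨁ j, A i j) : row k A i (ofRow k A i v) = v := by
  classical
  exact DirectSum.component.lof_self (M := fun i => ⨁ j, A i j) k i v

theorem row_ofRow_ne {i i' : ι} (h : i ≠ i') (v : ⨁ j, A i j) :
    row k A i' (ofRow k A i v) = 0 := by
  classical
  refine (DirectSum.component.of (M := fun i => ⨁ j, A i j) k i' i v).trans ?_
  rw [dif_neg h]

theorem induction_on {p : GMAlgebra k A → Prop} (x : GMAlgebra k A) (zero : p 0)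
    (single : ∀ i j (a : A i j), p (single k A i j a)) (add : ∀ x y, p x → p y → p (x + y)) :
    p x := by
  classical
  refine DirectSum.induction_on (β := fun i => ⨁ j, A i j) x zero (fun i v => ?_) add
  have hrow : ∀ v : ⨁ j, A i j, p (ofRow k A i v) := by
    intro v
    induction v using DirectSum.induction_on with
    | zero => rw [map_zero]; exact zero
    | of j a => exact single i j a
    | add v w hv hw => rw [map_add]; exact add _ _ hv hw
  exact hrow v

variable [GammaSystem k A]

variable (k A) in
/-- A row vector multiplied entrywise by `x`. -/
noncomputable def rowMul {i j : ι} (x : A i j) : (⨁ l, A j l) →ₗ[k] ⨁ l, A i l :=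
  DirectSum.lmap (fun l => GammaSystem.mul (k := k) i j l x)

variable (k A) in
/-- Left multiplication by the matrix with the single entry `x` at `(i, j)`: the `j`-th row
of the other factor is multiplied by `x` entrywise and becomes the `i`-th row. -/
noncomputable def mulAux (i j : ι) : A i j →ₗ[k] GMAlgebra k A →ₗ[k] GMAlgebra k A where
  toFun x := ofRow k A i ∘ₗ rowMul k A x ∘ₗ row k A j
  map_add' x x' := by
    have h : rowMul k A (x + x') = rowMul k A x + rowMul k A x' := by
      refine LinearMap.ext fun v => DirectSum.ext_component k fun l => ?_
      exact LinearMap.congr_fun (map_add (GammaSystem.mul (k := k) i j l) x x') (v l)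
    rw [h, LinearMap.add_comp, LinearMap.comp_add]
  map_smul' c x := by
    have h : rowMul k A (c • x) = c • rowMul k A x := by
      refine LinearMap.ext fun v => DirectSum.ext_component k fun l => ?_
      exact LinearMap.congr_fun (map_smul (GammaSystem.mul (k := k) i j l) c x) (v l)
    rw [h, LinearMap.smul_comp, LinearMap.comp_smul, RingHom.id_apply]

open scoped Classical in
variable (k A) in
/-- Matrix multiplication, `(x y) i l = ∑ j, x i j * y j l`, as a bilinear map. -/
noncomputable def mulLin : GMAlgebra k A →ₗ[k] GMAlgebra k A →ₗ[k] GMAlgebra k A :=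
  DirectSum.toModule k ι _ fun i => DirectSum.toModule k ι _ fun j => mulAux k A i j

noncomputable instance : Mul (GMAlgebra k A) := ⟨fun x y => mulLin k A x y⟩

theorem mul_def (x y : GMAlgebra k A) : x * y = mulLin k A x y := rfl

theorem single_mul {i j : ι} (x : A i j) (y : GMAlgebra k A) :
    single k A i j x * y = ofRow k A i (rowMul k A x (row k A j y)) := by
  classical
  have h : mulLin k A (single k A i j x) = mulAux k A i j x := by
    refine (DirectSum.toModule_lof k i _).trans ?_
    exact DirectSum.toModule_lof k j _
  rw [mul_def, h]
  rfl

theorem single_mul_single {i j l : ι} (x : A i j) (y : A j l) :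
    single k A i j x * single k A j l y = single k A i l (GammaSystem.mul (k := k) i j l x y) := by
  classical
  rw [single_mul]
  simp only [single, LinearMap.comp_apply, row_ofRow_same]
  congr 1
  exact DirectSum.lmap_lof _ l y

theorem single_mul_single_of_ne {i j j' l : ι} (h : j ≠ j') (x : A i j) (y : A j' l) :
    single k A i j x * single k A j' l y = 0 := by
  rw [single_mul]
  simp only [single, LinearMap.comp_apply, row_ofRow_ne h.symm, map_zero]

protected theorem add_mul (x y z : GMAlgebra k A) : (x + y) * z = x * z + y * z := by
  simp only [mul_def, map_add, LinearMap.add_apply]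

protected theorem mul_add (x y z : GMAlgebra k A) : x * (y + z) = x * y + x * z := by
  simp only [mul_def, map_add]

protected theorem zero_mul (x : GMAlgebra k A) : 0 * x = 0 := by
  simp only [mul_def, map_zero, LinearMap.zero_apply]

protected theorem mul_zero (x : GMAlgebra k A) : x * 0 = 0 := by
  simp only [mul_def, map_zero]

protected theorem mul_assoc (x y z : GMAlgebra k A) : x * y * z = x * (y * z) := by
  induction x using induction_on with
  | zero => simp only [GMAlgebra.zero_mul]
  | add x x' hx hx' => simp only [GMAlgebra.add_mul, hx, hx']
  | single i j a =>
    induction y using induction_on with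
    | zero => simp only [GMAlgebra.zero_mul, GMAlgebra.mul_zero]
    | add y y' hy hy' => simp only [GMAlgebra.add_mul, GMAlgebra.mul_add, hy, hy']
    | single i' j' b =>
      induction z using induction_on with
      | zero => simp only [GMAlgebra.mul_zero]
      | add z z' hz hz' => simp only [GMAlgebra.mul_add, hz, hz']
      | single i'' j'' c =>
        by_cases h : j = i'
        · subst h
          by_cases h' : j' = i''
          · subst h'
            rw [single_mul_single, single_mul_single, single_mul_single, single_mul_single,
              GammaSystem.mul_assoc]
          · rw [single_mul_single, single_mul_single_of_ne h', single_mul_single_of_ne h',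
              GMAlgebra.mul_zero]
        · by_cases h' : j' = i''
          · subst h'
            rw [single_mul_single_of_ne h, GMAlgebra.zero_mul, single_mul_single,
              single_mul_single_of_ne h]
          · rw [single_mul_single_of_ne h, GMAlgebra.zero_mul, single_mul_single_of_ne h',
              GMAlgebra.mul_zero]

noncomputable instance : NonUnitalRing (GMAlgebra k A) where
  left_distrib := GMAlgebra.mul_add
  right_distrib := GMAlgebra.add_mul
  zero_mul := GMAlgebra.zero_mul
  mul_zero := GMAlgebra.mul_zero
  mul_assoc := GMAlgebra.mul_assoc

instance : IsScalarTower k (GMAlgebra k A) (GMAlgebra k A) where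
  smul_assoc c x y := by
    simp only [smul_eq_mul, mul_def, map_smul, LinearMap.smul_apply]

instance : SMulCommClass k (GMAlgebra k A) (GMAlgebra k A) where
  smul_comm c x y := by
    simp only [smul_eq_mul, mul_def, map_smul]

end GMAlgebra

/-! ### Generalized path algebras -/

section GPath

variable {ι : Type*} [Quiver ι] (Ω : ι → Type*)

/-- Generalized paths `a₀ x₁ a₁ x₂ ⋯ xₙ aₙ` from `i` to `j`: the `xₚ` are consecutive arrows and
`aₚ ∈ Ω` at the vertex between `xₚ` and `xₚ₊₁`. A path of length zero is an element of `Ω i`.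
Zero entries are allowed here; `pathRelations` makes the paths having them vanish. -/
inductive GPath : ι → ι → Type _
  | nil {i : ι} (a : Ω i) : GPath i i
  | cons {i j l : ι} (p : GPath i j) (x : j ⟶ l) (a : Ω l) : GPath i l

variable {Ω} [∀ i, Ring (Ω i)]

namespace GPath

/-- `(a₀ x₁ ⋯ xₙ aₙ) b = a₀ x₁ ⋯ xₙ (aₙ b)`. -/
def mulLast {i j : ι} : GPath Ω i j → Ω j → GPath Ω i j
  | nil a, b => nil (a * b)
  | cons p x a, b => cons p x (a * b)

/-- `(a₀ x₁ ⋯ xₙ aₙ) (b₀ y₁ ⋯ yₘ bₘ) = a₀ x₁ ⋯ xₙ (aₙ b₀) y₁ ⋯ yₘ bₘ`. -/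
def comp {i j l : ι} (p : GPath Ω i j) : GPath Ω j l → GPath Ω i l
  | nil b => p.mulLast b
  | cons q x a => cons (p.comp q) x a

/-- `AddRel p q r`: the generalized paths `p`, `q`, `r` agree except for the entry in one place,
where the entry of `p` is the sum of the entries of `q` and `r`. -/
inductive AddRel : ∀ {i j : ι}, GPath Ω i j → GPath Ω i j → GPath Ω i j → Prop
  | nil {i : ι} (a b : Ω i) : AddRel (nil (a + b)) (nil a) (nil b)
  | last {i j l : ι} (p : GPath Ω i j) (x : j ⟶ l) (a b : Ω l) :
      AddRel (cons p x (a + b)) (cons p x a) (cons p x b)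
  | cons {i j l : ι} {p q r : GPath Ω i j} (x : j ⟶ l) (a : Ω l) :
      AddRel p q r → AddRel (cons p x a) (cons q x a) (cons r x a)

variable {k : Type*} [Field k] [∀ i, Algebra k (Ω i)]

/-- `SMulRel c p q`: the generalized paths `p`, `q` agree except for the entry in one place,
where the entry of `p` is `c` times the entry of `q`. -/
inductive SMulRel (c : k) : ∀ {i j : ι}, GPath Ω i j → GPath Ω i j → Prop
  | nil {i : ι} (a : Ω i) : SMulRel c (nil (c • a)) (nil a)
  | last {i j l : ι} (p : GPath Ω i j) (x : j ⟶ l) (a : Ω l) :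
      SMulRel c (cons p x (c • a)) (cons p x a)
  | cons {i j l : ι} {p q : GPath Ω i j} (x : j ⟶ l) (a : Ω l) :
      SMulRel c p q → SMulRel c (cons p x a) (cons q x a)

theorem mulLast_mulLast {i j : ι} (p : GPath Ω i j) (a b : Ω j) :
    (p.mulLast a).mulLast b = p.mulLast (a * b) := by
  cases p <;> simp [mulLast, mul_assoc]

theorem comp_mulLast {i j l : ι} (p : GPath Ω i j) (q : GPath Ω j l) (b : Ω l) :
    p.comp (q.mulLast b) = (p.comp q).mulLast b := by
  cases q with
  | nil a => exact (mulLast_mulLast p a b).symm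
  | cons q x a => rfl

theorem comp_assoc {i j l s : ι} (p : GPath Ω i j) (q : GPath Ω j l) (r : GPath Ω l s) :
    (p.comp q).comp r = p.comp (q.comp r) := by
  induction r with
  | nil b => simp [comp, comp_mulLast]
  | cons r x a ih => simp [comp, ih]

theorem AddRel.mulLast_left {i j : ι} {p q r : GPath Ω i j} (h : AddRel p q r) (b : Ω j) :
    AddRel (p.mulLast b) (q.mulLast b) (r.mulLast b) := by
  cases h with
  | nil a a' => simpa [mulLast, add_mul] using AddRel.nil (a * b) (a' * b)
  | last p x a a' => simpa [mulLast, add_mul] using AddRel.last p x (a * b) (a' * b)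
  | cons x a h => exact AddRel.cons x (a * b) h

theorem AddRel.mulLast_right {i j : ι} (p : GPath Ω i j) (a b : Ω j) :
    AddRel (p.mulLast (a + b)) (p.mulLast a) (p.mulLast b) := by
  cases p with
  | nil c => simpa [mulLast, mul_add] using AddRel.nil (c * a) (c * b)
  | cons p x c => simpa [mulLast, mul_add] using AddRel.last p x (c * a) (c * b)

theorem AddRel.comp_left {i j l : ι} {p q r : GPath Ω i j} (h : AddRel p q r) (s : GPath Ω j l) :
    AddRel (p.comp s) (q.comp s) (r.comp s) := by
  induction s with
  | nil b => exact h.mulLast_left b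
  | cons s x a ih => exact AddRel.cons x a ih

theorem AddRel.comp_right {i j l : ι} (s : GPath Ω i j) {p q r : GPath Ω j l}
    (h : AddRel p q r) : AddRel (s.comp p) (s.comp q) (s.comp r) := by
  induction h with
  | nil a b => exact AddRel.mulLast_right s a b
  | last p x a b => exact AddRel.last (s.comp p) x a b
  | cons x a h ih => exact AddRel.cons x a ih

theorem SMulRel.mulLast_left {c : k} {i j : ι} {p q : GPath Ω i j} (h : SMulRel c p q)
    (b : Ω j) : SMulRel c (p.mulLast b) (q.mulLast b) := by
  cases h with
  | nil a => simpa [mulLast] using SMulRel.nil (c := c) (a * b)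
  | last p x a => simpa [mulLast] using SMulRel.last (c := c) p x (a * b)
  | cons x a h => exact SMulRel.cons x (a * b) h

theorem SMulRel.mulLast_right (c : k) {i j : ι} (p : GPath Ω i j) (a : Ω j) :
    SMulRel c (p.mulLast (c • a)) (p.mulLast a) := by
  cases p with
  | nil b => simpa [mulLast] using SMulRel.nil (c := c) (b * a)
  | cons p x b => simpa [mulLast] using SMulRel.last (c := c) p x (b * a)

theorem SMulRel.comp_left {c : k} {i j l : ι} {p q : GPath Ω i j} (h : SMulRel c p q)
    (s : GPath Ω j l) : SMulRel c (p.comp s) (q.comp s) := by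
  induction s with
  | nil b => exact h.mulLast_left b
  | cons s x a ih => exact SMulRel.cons x a ih

theorem SMulRel.comp_right {c : k} {i j l : ι} (s : GPath Ω i j) {p q : GPath Ω j l}
    (h : SMulRel c p q) : SMulRel c (s.comp p) (s.comp q) := by
  induction h with
  | nil a => exact SMulRel.mulLast_right c s a
  | last p x a => exact SMulRel.last (s.comp p) x a
  | cons x a h ih => exact SMulRel.cons x a ih

end GPath

variable (k : Type*) [Field k] (Ω) [∀ i, Algebra k (Ω i)]

/-- The subspace of the vector space on all generalized paths from `i` to `j` which expresses
that a generalized path is `k`-linear in each of its entries. -/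
noncomputable def pathRelations (i j : ι) : Submodule k (GPath Ω i j →₀ k) :=
  Submodule.span k
    ({z | ∃ p q r : GPath Ω i j, GPath.AddRel p q r ∧
        z = Finsupp.single p 1 - (Finsupp.single q 1 + Finsupp.single r 1)} ∪
      {z | ∃ (c : k) (p q : GPath Ω i j), GPath.SMulRel c p q ∧
        z = Finsupp.single p 1 - c • Finsupp.single q 1})

/-- The component of the generalized path algebra at `(i, j)`. -/
def PathSpace (i j : ι) : Type _ := (GPath Ω i j →₀ k) ⧸ pathRelations Ω k i j

namespace PathSpace

noncomputable instance (i j : ι) : AddCommGroup (PathSpace Ω k i j) :=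
  inferInstanceAs (AddCommGroup ((GPath Ω i j →₀ k) ⧸ pathRelations Ω k i j))

noncomputable instance (i j : ι) : Module k (PathSpace Ω k i j) :=
  inferInstanceAs (Module k ((GPath Ω i j →₀ k) ⧸ pathRelations Ω k i j))

variable {Ω}

/-- The quotient map. -/
noncomputable def proj (i j : ι) : (GPath Ω i j →₀ k) →ₗ[k] PathSpace Ω k i j :=
  (pathRelations Ω k i j).mkQ

/-- The class of a generalized path. -/
noncomputable def mk {i j : ι} (p : GPath Ω i j) : PathSpace Ω k i j :=
  proj k i j (Finsupp.single p 1)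

theorem mk_of_addRel {i j : ι} {p q r : GPath Ω i j} (h : GPath.AddRel p q r) :
    mk k p = mk k q + mk k r := by
  have : proj k i j
      (Finsupp.single p 1 - (Finsupp.single q 1 + Finsupp.single r 1)) = 0 :=
    (Submodule.Quotient.mk_eq_zero _).2 (Submodule.subset_span (Or.inl ⟨p, q, r, h, rfl⟩))
  rw [map_sub, map_add, sub_eq_zero] at this
  exact this

variable {k} in
theorem mk_of_smulRel {c : k} {i j : ι} {p q : GPath Ω i j} (h : GPath.SMulRel c p q) :
    mk k p = c • mk k q := by
  have : proj k i j (Finsupp.single p 1 - c • Finsupp.single q 1) = 0 :=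
    (Submodule.Quotient.mk_eq_zero _).2 (Submodule.subset_span (Or.inr ⟨c, p, q, h, rfl⟩))
  rw [map_sub, map_smul, sub_eq_zero] at this
  exact this

variable {k} in
/-- A function on generalized paths which is linear in each entry extends to the component. -/
noncomputable def lift {i j : ι} {M : Type*} [AddCommGroup M] [Module k M] (f : GPath Ω i j → M)
    (hadd : ∀ p q r, GPath.AddRel p q r → f p = f q + f r)
    (hsmul : ∀ (c : k) p q, GPath.SMulRel c p q → f p = c • f q) : PathSpace Ω k i j →ₗ[k] M :=
  (pathRelations Ω k i j).liftQ (Finsupp.linearCombination k f) (by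
    refine Submodule.span_le.2 ?_
    rintro z (⟨p, q, r, h, rfl⟩ | ⟨c, p, q, h, rfl⟩)
    · simp [hadd p q r h]
    · simp [hsmul c p q h])

theorem lift_mk {i j : ι} {M : Type*} [AddCommGroup M] [Module k M] (f : GPath Ω i j → M)
    (hadd : ∀ p q r, GPath.AddRel p q r → f p = f q + f r)
    (hsmul : ∀ (c : k) p q, GPath.SMulRel c p q → f p = c • f q) (p : GPath Ω i j) :
    lift f hadd hsmul (mk k p) = f p := by
  refine (Submodule.liftQ_apply _ _ _).trans ?_
  simp

variable {k} in
theorem hom_ext {i j : ι} {M : Type*} [AddCommGroup M] [Module k M]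
    {f g : PathSpace Ω k i j →ₗ[k] M} (h : ∀ p, f (mk k p) = g (mk k p)) : f = g := by
  refine Submodule.linearMap_qext _ (Finsupp.lhom_ext' fun p => LinearMap.ext_ring ?_)
  exact h p

/-- Multiplication of components, induced by the composition of generalized paths. -/
noncomputable def mul (i j l : ι) :
    PathSpace Ω k i j →ₗ[k] PathSpace Ω k j l →ₗ[k] PathSpace Ω k i l :=
  lift (fun p => lift (fun q => mk k (p.comp q))
      (fun _ _ _ h => mk_of_addRel k (h.comp_right p))
      (fun _ _ _ h => mk_of_smulRel (h.comp_right p)))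
    (fun p q r h => hom_ext fun s => by
      simp only [lift_mk, LinearMap.add_apply, mk_of_addRel k (h.comp_left s)])
    (fun c p q h => hom_ext fun s => by
      simp only [lift_mk, LinearMap.smul_apply, mk_of_smulRel (h.comp_left s)])

theorem mul_mk_mk {i j l : ι} (p : GPath Ω i j) (q : GPath Ω j l) :
    mul k i j l (mk k p) (mk k q) = mk k (p.comp q) := by
  simp only [mul, lift_mk]

theorem induction_on {i j : ι} {P : PathSpace Ω k i j → Prop} (x : PathSpace Ω k i j)
    (zero : P 0) (smul : ∀ (c : k) p, P (c • mk k p)) (add : ∀ x y, P x → P y → P (x + y)) :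
    P x := by
  obtain ⟨z, rfl⟩ : ∃ z, proj k i j z = x := (pathRelations Ω k i j).mkQ_surjective x
  induction z using Finsupp.induction_linear with
  | zero => rw [map_zero]; exact zero
  | add z w hz hw => rw [map_add]; exact add _ _ hz hw
  | single p c =>
    have h := smul c p
    rw [mk, ← map_smul, Finsupp.smul_single, smul_eq_mul, mul_one] at h
    exact h

noncomputable instance : GammaSystem k (PathSpace Ω k) where
  mul := mul k
  mul_assoc i j l s x y z := by
    induction x using induction_on with
    | zero => simp only [map_zero, LinearMap.zero_apply]
    | add x x' hx hx' => simp only [map_add, LinearMap.add_apply, hx, hx']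
    | smul c p =>
      induction y using induction_on with
      | zero => simp only [map_zero, LinearMap.zero_apply]
      | add y y' hy hy' => simp only [map_add, LinearMap.add_apply, hy, hy']
      | smul c' q =>
        induction z using induction_on with
        | zero => simp only [map_zero]
        | add z z' hz hz' => simp only [map_add, hz, hz']
        | smul c'' r =>
          simp only [map_smul, LinearMap.smul_apply, mul_mk_mk, GPath.comp_assoc]

end PathSpace

/-- The generalized path algebra `k(D, Ω)` of the directed graph with vertex set `ι` and arrows
`i ⟶ j`, and of the family of `k`-algebras `Ω i`. -/
abbrev GPathAlgebra : Type _ := GMAlgebra k (PathSpace Ω k)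

namespace GPathAlgebra

variable {Ω}

/-- The element of `k(D, Ω)` given by a generalized path. -/
noncomputable def ofPath {i j : ι} (p : GPath Ω i j) : GPathAlgebra Ω k :=
  GMAlgebra.single k (PathSpace Ω k) i j (PathSpace.mk k p)

/-- The arrow `x : i ⟶ j` as an element of `k(D, Ω)`, i.e. `eᵢ x eⱼ`. -/
noncomputable def arrow {i j : ι} (x : i ⟶ j) : GPathAlgebra Ω k :=
  ofPath k (GPath.cons (GPath.nil 1) x 1)

variable (Ω)

/-- The ideal `J` generated by all arrows. -/
noncomputable def arrowIdeal : TwoSidedIdeal (GPathAlgebra Ω k) :=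
  TwoSidedIdeal.span {z | ∃ (i j : ι) (x : i ⟶ j), z = arrow k x}

variable {Ω}

/-- A set of weak relations: a non-empty set `ρ` with `J ^ t ⊆ (ρ) ⊆ J` for some `t ≥ 1`. -/
def IsWeakRelationSet (ρ : Set (GPathAlgebra Ω k)) : Prop :=
  ρ.Nonempty ∧
  (∃ n : ℕ, ∀ z ∈ idealPowSucc (arrowIdeal Ω k) n, z ∈ TwoSidedIdeal.span ρ) ∧
  TwoSidedIdeal.span ρ ≤ arrowIdeal Ω k

end GPathAlgebra

end GPath

/-- `Λ` is isomorphic, as a `k`-algebra, to a generalized path algebra `k(D, Ω)/(ρ)` with weak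
relations. The directed graph `D` is arbitrary with non-empty vertex set, and each `Ω i` is a
non-zero unital `k`-algebra with zero Jacobson radical. As `k(D, Ω)` has local units, the ideal
`(ρ)` is a subspace; the last clause says that the ring isomorphism is `k`-linear. -/
def IsGPathAlgebraWithWeakRelations (k : Type u) [Field k] (Λ : Type v) [NonUnitalRing Λ]
    [Module k Λ] : Prop :=
  ∃ (I : Type v) (_ : Nonempty I) (_ : Quiver.{v} I) (Ω : I → Type v)
    (_ : ∀ i, Ring (Ω i)) (_ : ∀ i, Algebra k (Ω i)) (ρ : Set (GPathAlgebra Ω k)),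
    (∀ i, Nontrivial (Ω i)) ∧
    (∀ i, jacobsonRadical (Ω i) = ⊥) ∧
    GPathAlgebra.IsWeakRelationSet k ρ ∧
    ∃ φ : (TwoSidedIdeal.span ρ).ringCon.Quotient ≃+* Λ,
      ∀ (c : k) (x : GPathAlgebra Ω k),
        φ ((c • x : GPathAlgebra Ω k) : (TwoSidedIdeal.span ρ).ringCon.Quotient) =
          c • φ (x : (TwoSidedIdeal.span ρ).ringCon.Quotient)

/-! ### Radicals, powers of ideals and quotients -/

section Radical

variable {R : Type*} [NonUnitalRing R]

/-! Both directions compare `r(Λ)` with the arrow ideal `J` along a surjection `ψ : k(D, Ω) → Λ`,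
using the splitting `k(D, Ω) = (⨁ Ω i) ⊕ J`, where `J` is exactly the kernel of the projection
`toPi` to `∏ Ω i` (`toPi_eq_zero_iff`).

From weak relations to the structure of `Λ`: the kernel of `ψ` contains a power of `J`, so `ψ(J)` is
a nilpotent ideal and lies in `r(Λ)`. The kernel is contained in `J`, so each `Ω i` is a quotient of
`Λ`; its radical being zero, `r(Λ)` dies in every `Ω i`. Hence the preimage of `r(Λ)` is `J`. Thus
the image of `⨁ Ω i` is a complement of the radical, the radical is nilpotent, and the vertex
idempotents form a gm unit that is central modulo the radical.

Conversely, the `A`-components `f i` of the given `e i` are orthogonal idempotents central in `A`,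
because `A` embeds in `Λ/r(Λ)`; nilpotency of the radical keeps them complete
(`IsGMUnit.exists_mem_complement`). Take `Ω i = f i A f i`, which has zero radical
(`SubalgebraCorner.jacobsonRadical_eq_bot`), and take every element of `f i r(Λ) f j` as an arrow `i
⟶ j`; no choice of generators is needed. Evaluating paths (`GPathAlgebra.lift`) is surjective, is
injective from `⨁ Ω i` into `A`, and sends `J` into `r(Λ)`. So its kernel lies in `J` and contains a
power of `J`, and the whole kernel serves as `ρ`. -/

theorem mem_jacobsonRadical_of_mem {I : TwoSidedIdeal R} (hI : IsQuasiregularIdeal I) {x : R}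
    (hx : x ∈ I) : x ∈ jacobsonRadical R :=
  TwoSidedIdeal.le_iff.1 (isGreatest_jacobsonRadical.2 hI) hx

theorem isQuasiregular_of_mem_jacobsonRadical {x : R} (hx : x ∈ jacobsonRadical R) :
    IsQuasiregular x :=
  isGreatest_jacobsonRadical.1 x hx

/-- A quasi-inverse `y` of `-e` satisfies `y - e - e * y = 0`; multiplying by `e` on the left
cancels the terms in `y` and leaves `e = 0`. -/
theorem eq_zero_of_isIdempotentElem_of_mem_jacobsonRadical {e : R} (he : e * e = e)
    (hr : e ∈ jacobsonRadical R) : e = 0 := by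
  obtain ⟨y, h, -⟩ := isQuasiregular_iff.1
    (isQuasiregular_of_mem_jacobsonRadical ((jacobsonRadical R).neg_mem hr))
  have h' := congrArg (e * ·) h
  simpa [mul_add, ← mul_assoc, he] using h'

theorem mem_idealPowSucc_zero {I : TwoSidedIdeal R} {x : R} : x ∈ idealPowSucc I 0 ↔ x ∈ I := by
  refine ⟨fun hx => ?_, fun hx => AddSubgroup.subset_closure hx⟩
  have h : idealPowSucc I 0 ≤ (AddSubgroup.ofClass I) :=
    (AddSubgroup.closure_le _).2 fun y hy => hy
  exact h hx

theorem mul_mem_idealPowSucc_succ {I : TwoSidedIdeal R} {n : ℕ} {x y : R}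
    (hx : x ∈ idealPowSucc I n) (hy : y ∈ I) : x * y ∈ idealPowSucc I (n + 1) :=
  AddSubgroup.subset_closure ⟨x, hx, y, hy, rfl⟩

/-- The powers are built by multiplication on the right; associativity gives the left-handed rule,
needed when error terms accumulate on the left. -/
theorem mul_mem_idealPowSucc_succ' {I : TwoSidedIdeal R} {n : ℕ} {x y : R}
    (hx : x ∈ I) (hy : y ∈ idealPowSucc I n) : x * y ∈ idealPowSucc I (n + 1) := by
  induction n generalizing y with
  | zero =>
    exact mul_mem_idealPowSucc_succ (mem_idealPowSucc_zero.2 hx) (mem_idealPowSucc_zero.1 hy)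
  | succ n ih =>
    have h : idealPowSucc I (n + 1) ≤
        (idealPowSucc I (n + 1 + 1)).comap (AddMonoidHom.mulLeft x) := by
      refine (AddSubgroup.closure_le _).2 ?_
      rintro _ ⟨a, ha, b, hb, rfl⟩
      change x * (a * b) ∈ idealPowSucc I (n + 1 + 1)
      rw [← mul_assoc]
      exact mul_mem_idealPowSucc_succ (ih ha) hb
    exact h hy

/-- In the unitization over `ℤ`, quasi-regularity of `x` means that `1 + x` is a unit, and one plus
a nilpotent element is a unit. -/
theorem IsNilpotentIdeal.isQuasiregularIdeal {I : TwoSidedIdeal R} (hI : IsNilpotentIdeal I) :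
    IsQuasiregularIdeal I := by
  intro x hx
  obtain ⟨n, hn⟩ := hI
  have key : ∀ m, ∃ y ∈ idealPowSucc I m, (x : Unitization ℤ R) ^ (m + 1) = (y : R) := by
    intro m
    induction m with
    | zero => exact ⟨x, mem_idealPowSucc_zero.2 hx, by simp⟩
    | succ m ih =>
      obtain ⟨y, hy, h⟩ := ih
      exact ⟨y * x, mul_mem_idealPowSucc_succ hy hx, by
        rw [pow_succ, h, Unitization.inr_mul]⟩
  obtain ⟨y, hy, h⟩ := key n
  rw [hn, AddSubgroup.mem_bot] at hy
  rw [isQuasiregular_iff_isUnit' ℤ]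
  exact IsNilpotent.isUnit_one_add (R := Unitization ℤ R)
    ⟨n + 1, by rw [h, hy, Unitization.inr_zero]⟩

theorem idealPowSucc_le_map {S : Type*} [NonUnitalRing S] (f : R →ₙ+* S) {I : TwoSidedIdeal R}
    {J : TwoSidedIdeal S} (h : ∀ y ∈ J, ∃ x ∈ I, f x = y) (n : ℕ) :
    idealPowSucc J n ≤ (idealPowSucc I n).map (f : R →+ S) := by
  induction n with
  | zero =>
    intro y hy
    obtain ⟨x, hx, rfl⟩ := h y (mem_idealPowSucc_zero.1 hy)
    exact ⟨x, mem_idealPowSucc_zero.2 hx, rfl⟩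
  | succ n ih =>
    refine (AddSubgroup.closure_le _).2 ?_
    rintro _ ⟨a, ha, b, hb, rfl⟩
    obtain ⟨a, ha', rfl⟩ := ih ha
    obtain ⟨b, hb', rfl⟩ := h b hb
    exact ⟨a * b, mul_mem_idealPowSucc_succ ha' hb', map_mul f a b⟩

theorem map_mem_idealPowSucc {S : Type*} [NonUnitalRing S] (f : R →ₙ+* S) {I : TwoSidedIdeal R}
    {J : TwoSidedIdeal S} (h : ∀ x ∈ I, f x ∈ J) {n : ℕ} {x : R} (hx : x ∈ idealPowSucc I n) :
    f x ∈ idealPowSucc J n := by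
  have key : idealPowSucc I n ≤ (idealPowSucc J n).comap (f : R →+ S) := by
    clear hx
    induction n with
    | zero =>
      intro y hy
      have h' := h y (mem_idealPowSucc_zero.1 hy)
      exact (mem_idealPowSucc_zero (I := J)).2 h'
    | succ n ih =>
      refine (AddSubgroup.closure_le _).2 ?_
      rintro _ ⟨a, ha, b, hb, rfl⟩
      change f (a * b) ∈ idealPowSucc J (n + 1)
      rw [map_mul]
      exact mul_mem_idealPowSucc_succ (ih ha) (h b hb)
  exact key hx

/-- The image of a two-sided ideal under a surjective homomorphism. -/
def TwoSidedIdeal.image {S : Type*} [NonUnitalRing S] (f : R →ₙ+* S)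
    (hf : Function.Surjective f) (I : TwoSidedIdeal R) : TwoSidedIdeal S :=
  TwoSidedIdeal.mk' {y | ∃ x ∈ I, f x = y} ⟨0, I.zero_mem, map_zero f⟩
    (by
      rintro _ _ ⟨x, hx, rfl⟩ ⟨y, hy, rfl⟩
      exact ⟨x + y, I.add_mem hx hy, map_add f x y⟩)
    (by
      rintro _ ⟨x, hx, rfl⟩
      exact ⟨-x, I.neg_mem hx, map_neg f x⟩)
    (by
      rintro z _ ⟨x, hx, rfl⟩
      obtain ⟨z, rfl⟩ := hf z
      exact ⟨z * x, I.mul_mem_left _ _ hx, map_mul f z x⟩)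
    (by
      rintro _ z ⟨x, hx, rfl⟩
      obtain ⟨z, rfl⟩ := hf z
      exact ⟨x * z, I.mul_mem_right _ _ hx, map_mul f x z⟩)

theorem TwoSidedIdeal.mem_image {S : Type*} [NonUnitalRing S] {f : R →ₙ+* S}
    {hf : Function.Surjective f} {I : TwoSidedIdeal R} {y : S} :
    y ∈ I.image f hf ↔ ∃ x ∈ I, f x = y :=
  TwoSidedIdeal.mem_mk' _ _ _ _ _ _ y

/-- Surjectivity makes the image of the radical an ideal, and quasi-inverses are carried to
quasi-inverses. -/
theorem map_mem_jacobsonRadical {S : Type*} [NonUnitalRing S] {f : R →ₙ+* S}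
    (hf : Function.Surjective f) {x : R} (hx : x ∈ jacobsonRadical R) :
    f x ∈ jacobsonRadical S := by
  refine mem_jacobsonRadical_of_mem (I := (jacobsonRadical R).image f hf) ?_
    (TwoSidedIdeal.mem_image.2 ⟨x, hx, rfl⟩)
  intro y hy
  obtain ⟨z, hz, rfl⟩ := TwoSidedIdeal.mem_image.1 hy
  obtain ⟨w, h1, h2⟩ := isQuasiregular_iff.1 (isQuasiregular_of_mem_jacobsonRadical hz)
  exact isQuasiregular_iff.2 ⟨f w, by rw [← map_mul, ← map_add, ← map_add, h1, map_zero],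
    by rw [← map_mul, ← map_add, ← map_add, h2, map_zero]⟩

theorem exists_comp_eq_of_surjective {S T : Type*} [NonUnitalRing S] [NonUnitalRing T]
    {f : R →ₙ+* S} (hf : Function.Surjective f) (g : R →ₙ+* T) (h : ∀ x, f x = 0 → g x = 0) :
    ∃ g' : S →ₙ+* T, ∀ x, g' (f x) = g x := by
  have key : ∀ x y, f x = f y → g x = g y := fun x y hxy => by
    rw [← sub_eq_zero, ← map_sub]
    exact h _ (by rw [map_sub, hxy, sub_self])
  have hs : ∀ y, f (Function.surjInv hf y) = y := Function.surjInv_eq hf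
  refine ⟨{ toFun := fun y => g (Function.surjInv hf y), map_mul' := ?_, map_zero' := ?_,
            map_add' := ?_ }, fun x => key _ _ (hs _)⟩
  · intro x y
    rw [← map_mul]
    exact key _ _ (by rw [map_mul, hs, hs, hs])
  · rw [← map_zero g]
    exact key _ _ (by rw [hs, map_zero])
  · intro x y
    rw [← map_add]
    exact key _ _ (by rw [map_add, hs, hs, hs])

namespace TwoSidedIdeal

theorem coe_quotient_eq_coe {I : TwoSidedIdeal R} {x y : R} :
    (x : I.ringCon.Quotient) = y ↔ x - y ∈ I := by
  rw [RingCon.eq, rel_iff]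

theorem exists_quotient_equiv {S : Type*} [NonUnitalRing S] {f : R →ₙ+* S}
    (hf : Function.Surjective f) {I : TwoSidedIdeal R} (hI : ∀ x, f x = 0 ↔ x ∈ I) :
    ∃ φ : I.ringCon.Quotient ≃+* S, ∀ x : R, φ x = f x := by
  have key : ∀ x y : R, I.ringCon x y ↔ f x = f y := fun x y => by
    rw [rel_iff, ← hI, map_sub, sub_eq_zero]
  let g : I.ringCon.Quotient → S := fun q => Quotient.liftOn' q f fun x y h => (key x y).1 h
  have hg : Function.Bijective g := by
    refine ⟨?_, fun y => ?_⟩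
    · intro x y
      induction x using Quotient.inductionOn'
      induction y using Quotient.inductionOn'
      intro h
      exact Quotient.sound' ((key _ _).2 h)
    · obtain ⟨x, rfl⟩ := hf y
      exact ⟨(x : I.ringCon.Quotient), rfl⟩
  refine ⟨{ Equiv.ofBijective g hg with map_mul' := ?_, map_add' := ?_ }, fun x => rfl⟩
  · intro x y
    induction x using Quotient.inductionOn'
    induction y using Quotient.inductionOn'
    exact map_mul f _ _
  · intro x y
    induction x using Quotient.inductionOn'
    induction y using Quotient.inductionOn'
    exact map_add f _ _

end TwoSidedIdeal

theorem coe_mem_center_quotient_iff {I : TwoSidedIdeal R} {e : R} :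
    (e : I.ringCon.Quotient) ∈ Set.center I.ringCon.Quotient ↔ ∀ x, x * e - e * x ∈ I := by
  rw [Semigroup.mem_center_iff]
  refine ⟨fun h x => ?_, fun h q => ?_⟩
  · rw [← TwoSidedIdeal.coe_quotient_eq_coe, RingCon.coe_mul, RingCon.coe_mul]
    exact h _
  · induction q using Quotient.inductionOn' with
    | h x => exact TwoSidedIdeal.coe_quotient_eq_coe.2 (h x)

end Radical

/-! ### Families of orthogonal idempotents -/

section Idempotents

variable {R : Type*} [NonUnitalRing R] {ι : Type*} {e : ι → R}

theorem sum_mul_of_mem (hi : ∀ i, e i * e i = e i) (ho : ∀ i j, i ≠ j → e i * e j = 0)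
    {F : Finset ι} {i : ι} (h : i ∈ F) : (∑ j ∈ F, e j) * e i = e i := by
  rw [Finset.sum_mul, Finset.sum_eq_single_of_mem i h fun j _ hj => ho j i hj, hi]

theorem mul_sum_of_mem (hi : ∀ i, e i * e i = e i) (ho : ∀ i j, i ≠ j → e i * e j = 0)
    {F : Finset ι} {i : ι} (h : i ∈ F) : e i * (∑ j ∈ F, e j) = e i := by
  rw [Finset.mul_sum, Finset.sum_eq_single_of_mem i h fun j _ hj => ho i j hj.symm, hi]

/-- A larger partial sum absorbs a smaller one, so local units found for different elements can be
merged over the union of their index sets. -/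
theorem sum_mul_eq_of_subset (hi : ∀ i, e i * e i = e i) (ho : ∀ i j, i ≠ j → e i * e j = 0)
    {F G : Finset ι} (h : F ⊆ G) {x : R} (hx : (∑ j ∈ F, e j) * x = x) :
    (∑ j ∈ G, e j) * x = x := by
  rw [← hx, ← mul_assoc, Finset.mul_sum]
  congr 1
  exact Finset.sum_congr rfl fun i hi' => sum_mul_of_mem hi ho (h hi')

theorem mul_sum_eq_of_subset (hi : ∀ i, e i * e i = e i) (ho : ∀ i j, i ≠ j → e i * e j = 0)
    {F G : Finset ι} (h : F ⊆ G) {x : R} (hx : x * (∑ j ∈ F, e j) = x) :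
    x * (∑ j ∈ G, e j) = x := by
  rw [← hx, mul_assoc, Finset.sum_mul]
  congr 1
  exact Finset.sum_congr rfl fun i hi' => mul_sum_of_mem hi ho (h hi')

end Idempotents

/-! ### The universal property of generalized path algebras -/

section Lift

variable {ι : Type*} [Quiver ι] {Ω : ι → Type*} [∀ i, Ring (Ω i)]

theorem GPath.mulLast_one {i j : ι} (p : GPath Ω i j) : p.mulLast 1 = p := by
  cases p <;> simp [mulLast]

theorem GPath.nil_one_comp {i j : ι} (p : GPath Ω i j) : (GPath.nil 1).comp p = p := by
  induction p with
  | nil a => simp [comp, mulLast]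
  | cons p x a ih => simp [comp, ih]

variable {k : Type*} [Field k] [∀ i, Algebra k (Ω i)]
  {Λ : Type*} [NonUnitalRing Λ] [Module k Λ]

namespace GPath

/-- The value of a generalized path, given values of its entries and arrows. -/
def eval (φ : ∀ i, Ω i →ₙₐ[k] Λ) (g : ∀ {i j : ι}, (i ⟶ j) → Λ) :
    ∀ {i j : ι}, GPath Ω i j → Λ
  | _, _, nil a => φ _ a
  | _, _, cons p x a => eval φ g p * g x * φ _ a

variable (φ : ∀ i, Ω i →ₙₐ[k] Λ) (g : ∀ {i j : ι}, (i ⟶ j) → Λ)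

theorem eval_mulLast {i j : ι} (p : GPath Ω i j) (a : Ω j) :
    (p.mulLast a).eval φ g = p.eval φ g * φ j a := by
  cases p with
  | nil b => simp only [mulLast, eval, map_mul]
  | cons p x b => simp only [mulLast, eval, map_mul, mul_assoc]

theorem eval_comp {i j l : ι} (p : GPath Ω i j) (q : GPath Ω j l) :
    (p.comp q).eval φ g = p.eval φ g * q.eval φ g := by
  induction q with
  | nil a => simp only [comp, eval, eval_mulLast]
  | cons q x a ih => simp only [comp, eval, ih, mul_assoc]

/-- Inserting the unit at the end of `p` and at the start of `q` puts `φ j 1 * φ i' 1 = 0` in the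
middle. -/
theorem eval_mul_eval_of_ne (ho : ∀ i j, i ≠ j → φ i 1 * φ j 1 = 0) {i j i' j' : ι}
    (h : j ≠ i') (p : GPath Ω i j) (q : GPath Ω i' j') : p.eval φ g * q.eval φ g = 0 := by
  rw [← mulLast_one p, ← nil_one_comp q, eval_mulLast, eval_comp, eval, mul_assoc,
    ← mul_assoc (φ j 1), ho j i' h, zero_mul, mul_zero]

theorem eval_of_addRel {i j : ι} {p q r : GPath Ω i j} (h : AddRel p q r) :
    p.eval φ g = q.eval φ g + r.eval φ g := by
  induction h with
  | nil a b => simp only [eval, map_add]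
  | last p x a b => simp only [eval, map_add, mul_add]
  | cons x a h ih => simp only [eval, ih, add_mul]

variable [IsScalarTower k Λ Λ] [SMulCommClass k Λ Λ]

theorem eval_of_smulRel {c : k} {i j : ι} {p q : GPath Ω i j} (h : SMulRel c p q) :
    p.eval φ g = c • q.eval φ g := by
  induction h with
  | nil a => simp only [eval, map_smul]
  | last p x a => simp only [eval, map_smul, mul_smul_comm]
  | cons x a h ih => simp only [eval, ih, smul_mul_assoc]

end GPath

namespace GPathAlgebra

theorem induction_ofPath {P : GPathAlgebra Ω k → Prop} (x : GPathAlgebra Ω k)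
    (smul : ∀ (c : k) {i j : ι} (p : GPath Ω i j), P (c • ofPath k p))
    (zero : P 0) (add : ∀ x y, P x → P y → P (x + y)) : P x := by
  induction x using GMAlgebra.induction_on with
  | zero => exact zero
  | add x y hx hy => exact add x y hx hy
  | single i j a =>
    induction a using PathSpace.induction_on with
    | zero => rw [map_zero]; exact zero
    | smul c p => rw [map_smul]; exact smul c p
    | add a b ha hb => rw [map_add]; exact add _ _ ha hb

theorem ofPath_mul_ofPath {i j l : ι} (p : GPath Ω i j) (q : GPath Ω j l) :
    ofPath k p * ofPath k q = ofPath k (p.comp q) :=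
  (GMAlgebra.single_mul_single _ _).trans
    (congrArg (GMAlgebra.single k (PathSpace Ω k) i l) (PathSpace.mul_mk_mk k p q))

theorem ofPath_mul_ofPath_of_ne {i j i' j' : ι} (h : j ≠ i') (p : GPath Ω i j)
    (q : GPath Ω i' j') : ofPath k p * ofPath k q = 0 :=
  GMAlgebra.single_mul_single_of_ne h _ _

variable [IsScalarTower k Λ Λ] [SMulCommClass k Λ Λ]
  (φ : ∀ i, Ω i →ₙₐ[k] Λ) (g : ∀ {i j : ι}, (i ⟶ j) → Λ)

open scoped Classical in
/-- The linear map on the generalized path algebra given by the values of paths. -/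
noncomputable def evalLin : GPathAlgebra Ω k →ₗ[k] Λ :=
  DirectSum.toModule k ι Λ fun i => DirectSum.toModule k ι Λ fun j =>
    PathSpace.lift (GPath.eval φ g (i := i) (j := j))
      (fun _ _ _ h => GPath.eval_of_addRel φ g h) (fun _ _ _ h => GPath.eval_of_smulRel φ g h)

theorem evalLin_ofPath {i j : ι} (p : GPath Ω i j) :
    evalLin φ g (ofPath k p) = p.eval φ g := by
  classical
  refine (DirectSum.toModule_lof k i _).trans ?_
  refine (DirectSum.toModule_lof k j _).trans ?_
  exact PathSpace.lift_mk k _ _ _ p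

/-- Homomorphisms of the `Ω i` with orthogonal images, together with arbitrary values of the
arrows, extend to the generalized path algebra. -/
noncomputable def lift (ho : ∀ i j, i ≠ j → φ i 1 * φ j 1 = 0) : GPathAlgebra Ω k →ₙₐ[k] Λ :=
  { evalLin φ g with
    map_zero' := map_zero (evalLin φ g)
    map_mul' := by
      intro x y
      change evalLin φ g (x * y) = evalLin φ g x * evalLin φ g y
      induction x using induction_ofPath with
      | zero => simp only [zero_mul, map_zero]
      | add x x' hx hx' => simp only [add_mul, map_add, hx, hx']
      | smul c p =>
        induction y using induction_ofPath with
        | zero => simp only [mul_zero, map_zero]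
        | add y y' hy hy' => simp only [mul_add, map_add, hy, hy']
        | smul d q =>
          rename_i i j i' j'
          simp only [smul_mul_assoc, mul_smul_comm, map_smul, evalLin_ofPath]
          by_cases h : j = i'
          · subst h
            rw [ofPath_mul_ofPath, evalLin_ofPath, GPath.eval_comp]
          · rw [ofPath_mul_ofPath_of_ne h, GPath.eval_mul_eval_of_ne φ g ho h, map_zero] }

variable (ho : ∀ i j, i ≠ j → φ i 1 * φ j 1 = 0)

theorem lift_ofPath {i j : ι} (p : GPath Ω i j) : lift φ g ho (ofPath k p) = p.eval φ g :=
  evalLin_ofPath φ g p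

theorem lift_arrow {i j : ι} (x : i ⟶ j) :
    lift φ g ho (arrow k x) = φ i 1 * g x * φ j 1 := by
  rw [arrow, lift_ofPath]
  simp only [GPath.eval]

end GPathAlgebra

end Lift

/-! ### The semisimple part of a generalized path algebra -/

section Vertices

variable {ι : Type*} [Quiver ι] {Ω : ι → Type*} [∀ i, Ring (Ω i)]
  {k : Type*} [Field k] [∀ i, Algebra k (Ω i)]

namespace GPathAlgebra

variable (k) in
/-- The paths of length zero at the vertex `i`. -/
noncomputable def ofVertex (i : ι) : Ω i →ₗ[k] GPathAlgebra Ω k where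
  toFun a := ofPath k (GPath.nil a)
  map_add' a b := by
    have h := PathSpace.mk_of_addRel k (GPath.AddRel.nil a b)
    rw [ofPath, h, map_add]; rfl
  map_smul' c a := by
    have h := PathSpace.mk_of_smulRel (GPath.SMulRel.nil (c := c) a)
    rw [ofPath, h, map_smul]; rfl

theorem ofVertex_mul_ofVertex (i : ι) (a b : Ω i) :
    ofVertex k i a * ofVertex k i b = ofVertex k i (a * b) :=
  ofPath_mul_ofPath _ _

theorem ofVertex_mul_ofVertex_of_ne {i j : ι} (h : i ≠ j) (a : Ω i) (b : Ω j) :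
    ofVertex k i a * ofVertex k j b = 0 :=
  ofPath_mul_ofPath_of_ne h _ _

theorem ofVertex_one_mul_ofPath {i j : ι} (p : GPath Ω i j) :
    ofVertex k i 1 * ofPath k p = ofPath k p :=
  (ofPath_mul_ofPath _ _).trans (by rw [GPath.nil_one_comp])

theorem ofPath_mul_ofVertex_one {i j : ι} (p : GPath Ω i j) :
    ofPath k p * ofVertex k j 1 = ofPath k p :=
  (ofPath_mul_ofPath _ _).trans (congrArg (ofPath k) (GPath.mulLast_one p))

/-- Isolates the last arrow as a middle factor, which puts every path of positive length into the
arrow ideal. -/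
theorem cons_eq_comp {i j l : ι} (p : GPath Ω i j) (x : j ⟶ l) (a : Ω l) :
    GPath.cons p x a = (p.comp (GPath.cons (GPath.nil 1) x 1)).comp (GPath.nil a) := by
  simp only [GPath.comp]
  rw [GPath.mulLast_one]
  simp only [GPath.mulLast, one_mul]

theorem ofPath_cons_mem_arrowIdeal {i j l : ι} (p : GPath Ω i j) (x : j ⟶ l) (a : Ω l) :
    ofPath k (GPath.cons p x a) ∈ arrowIdeal Ω k := by
  rw [cons_eq_comp, ← ofPath_mul_ofPath, ← ofPath_mul_ofPath]
  exact TwoSidedIdeal.mul_mem_right _ _ _ (TwoSidedIdeal.mul_mem_left _ _ _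
    (TwoSidedIdeal.subset_span ⟨j, l, x, rfl⟩))

theorem isIdempotent_ofVertex_one (i : ι) :
    ofVertex k i (1 : Ω i) * ofVertex k i 1 = ofVertex k i 1 := by
  rw [ofVertex_mul_ofVertex, mul_one]

theorem exists_sum_ofVertex_one_mul (x : GPathAlgebra Ω k) : ∃ F : Finset ι,
    (∑ i ∈ F, ofVertex k i (1 : Ω i)) * x = x ∧ x * (∑ i ∈ F, ofVertex k i (1 : Ω i)) = x := by
  classical
  have hi := isIdempotent_ofVertex_one (k := k) (Ω := Ω)
  have ho : ∀ i j, i ≠ j → ofVertex k i (1 : Ω i) * ofVertex k j (1 : Ω j) = 0 :=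
    fun i j h => ofVertex_mul_ofVertex_of_ne h 1 1
  induction x using induction_ofPath with
  | zero => exact ⟨∅, by simp⟩
  | add x y hx hy =>
    obtain ⟨F, h1, h2⟩ := hx
    obtain ⟨G, h3, h4⟩ := hy
    refine ⟨F ∪ G, ?_, ?_⟩
    · rw [mul_add, sum_mul_eq_of_subset hi ho Finset.subset_union_left h1,
        sum_mul_eq_of_subset hi ho Finset.subset_union_right h3]
    · rw [add_mul, mul_sum_eq_of_subset hi ho Finset.subset_union_left h2,
        mul_sum_eq_of_subset hi ho Finset.subset_union_right h4]
  | smul c p =>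
    rename_i i j
    refine ⟨{i, j}, ?_, ?_⟩
    · rw [mul_smul_comm, sum_mul_eq_of_subset hi ho (F := {i}) (by simp)
        (by rw [Finset.sum_singleton, ofVertex_one_mul_ofPath])]
    · rw [smul_mul_assoc, mul_sum_eq_of_subset hi ho (F := {j}) (by simp)
        (by rw [Finset.sum_singleton, ofPath_mul_ofVertex_one])]

variable (Ω k) in
open scoped Classical in
/-- The direct sum of the `Ω i` inside the generalized path algebra. -/
noncomputable def ofVertices : (⨁ i, Ω i) →ₗ[k] GPathAlgebra Ω k :=
  DirectSum.toModule k ι _ (ofVertex k)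

open scoped Classical in
theorem ofVertices_of (i : ι) (a : Ω i) :
    ofVertices Ω k (DirectSum.of Ω i a) = ofVertex k i a :=
  DirectSum.toModule_lof k i a

theorem exists_eq_ofVertices_mul (d d' : ⨁ i, Ω i) :
    ∃ d'', ofVertices Ω k d * ofVertices Ω k d' = ofVertices Ω k d'' := by
  classical
  induction d using DirectSum.induction_on with
  | zero => exact ⟨0, by simp⟩
  | add d e hd he =>
    obtain ⟨u, hu⟩ := hd
    obtain ⟨w, hw⟩ := he
    exact ⟨u + w, by rw [map_add, add_mul, hu, hw, map_add]⟩
  | of i a =>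
    induction d' using DirectSum.induction_on with
    | zero => exact ⟨0, by simp⟩
    | add d e hd he =>
      obtain ⟨u, hu⟩ := hd
      obtain ⟨w, hw⟩ := he
      exact ⟨u + w, by rw [map_add, mul_add, hu, hw, map_add]⟩
    | of j b =>
      by_cases h : i = j
      · subst h
        exact ⟨DirectSum.of Ω i (a * b), by simp only [ofVertices_of, ofVertex_mul_ofVertex]⟩
      · exact ⟨0, by simp only [ofVertices_of, ofVertex_mul_ofVertex_of_ne h, map_zero]⟩

/-- The spanning half of the splitting into vertices and arrows; that the sum is direct is seen by
`toPi`. -/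
theorem exists_eq_ofVertices_add (x : GPathAlgebra Ω k) :
    ∃ (d : ⨁ i, Ω i), ∃ y ∈ arrowIdeal Ω k, x = ofVertices Ω k d + y := by
  classical
  induction x using induction_ofPath with
  | zero => exact ⟨0, 0, TwoSidedIdeal.zero_mem _, by simp⟩
  | add x x' hx hx' =>
    obtain ⟨d, y, hy, rfl⟩ := hx
    obtain ⟨d', y', hy', rfl⟩ := hx'
    exact ⟨d + d', y + y', TwoSidedIdeal.add_mem _ hy hy', by rw [map_add]; abel⟩
  | smul c p =>
    cases p with
    | nil a =>
      rename_i i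
      refine ⟨DirectSum.of Ω i (c • a), 0, TwoSidedIdeal.zero_mem _, ?_⟩
      rw [ofVertices_of, map_smul, add_zero]; rfl
    | cons p x a =>
      -- The scalar is absorbed into the last entry, since a two-sided ideal is not by definition
      -- closed under scalars.
      refine ⟨0, _, ofPath_cons_mem_arrowIdeal p x (c • a), ?_⟩
      have h := PathSpace.mk_of_smulRel (GPath.SMulRel.last (c := c) p x a)
      rw [map_zero, zero_add, ofPath, ofPath, h, map_smul]

variable (Ω k) in
open scoped Classical in
/-- The projection of the generalized path algebra to the product of the `Ω i`. -/
noncomputable def toPi : GPathAlgebra Ω k →ₙₐ[k] (∀ i, Ω i) :=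
  lift (fun i =>
      { toFun := Pi.single i
        map_smul' := fun c a => by
          ext j
          by_cases h : j = i
          · subst h; simp
          · simp [Pi.single_eq_of_ne h]
        map_zero' := Pi.single_zero i
        map_add' := Pi.single_add i
        map_mul' := Pi.single_mul i })
    (fun _ => 0) (fun i j h => by
      change (Pi.single i 1 : ∀ i, Ω i) * Pi.single j 1 = 0
      ext l
      by_cases hl : l = i
      · subst hl; simp [Pi.single_eq_of_ne h]
      · simp [Pi.single_eq_of_ne hl])

open scoped Classical in
theorem toPi_ofVertex (i : ι) (a : Ω i) : toPi Ω k (ofVertex k i a) = Pi.single i a := by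
  refine (lift_ofPath _ _ _ _).trans ?_
  simp only [GPath.eval]
  rfl

theorem toPi_ofVertices (d : ⨁ i, Ω i) (i : ι) : toPi Ω k (ofVertices Ω k d) i = d i := by
  classical
  induction d using DirectSum.induction_on with
  | zero => simp
  | add d e hd he => simp [hd, he]
  | of j a =>
    rw [ofVertices_of, toPi_ofVertex]
    by_cases h : i = j
    · subst h; simp
    · rw [Pi.single_eq_of_ne h, DirectSum.of_eq_of_ne _ _ _ h]

/-- Arrows are sent to zero. Conversely, in a decomposition of `x` into a vertex part `d` and a part
in the arrow ideal, `toPi` recovers every component of `d`, so `d = 0`. -/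
theorem toPi_eq_zero_iff {x : GPathAlgebra Ω k} : toPi Ω k x = 0 ↔ x ∈ arrowIdeal Ω k := by
  have key : ∀ y ∈ arrowIdeal Ω k, toPi Ω k y = 0 := by
    have h : arrowIdeal Ω k ≤ TwoSidedIdeal.ker (toPi Ω k) := by
      refine TwoSidedIdeal.span_le.2 ?_
      rintro _ ⟨i, j, x, rfl⟩
      refine (TwoSidedIdeal.mem_ker _).2 ?_
      rw [toPi, lift_arrow]
      simp
    exact fun y hy => (TwoSidedIdeal.mem_ker _).1 (h hy)
  refine ⟨fun hx => ?_, key x⟩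
  obtain ⟨d, y, hy, rfl⟩ := exists_eq_ofVertices_add x
  have hd : d = 0 := by
    refine DFunLike.ext _ _ fun i => ?_
    rw [map_add, key y hy, add_zero] at hx
    rw [← toPi_ofVertices (k := k), hx]
    rfl
  rwa [hd, map_zero, zero_add]

end GPathAlgebra

end Vertices

/-! ### Quotients of generalized path algebras by weak relations -/

section Quotient

variable {ι : Type*} [Quiver ι] {Ω : ι → Type*} [∀ i, Ring (Ω i)]
  {k : Type*} [Field k] [∀ i, Algebra k (Ω i)]
  {Λ : Type*} [NonUnitalRing Λ] [Module k Λ]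

namespace GPathAlgebra

variable {ψ : GPathAlgebra Ω k →ₙₐ[k] Λ}

theorem map_arrowIdeal_subset_jacobsonRadical (hψ : Function.Surjective ψ) {n : ℕ}
    (hn : ∀ x ∈ idealPowSucc (arrowIdeal Ω k) n, ψ x = 0) {x : GPathAlgebra Ω k}
    (hx : x ∈ arrowIdeal Ω k) : ψ x ∈ jacobsonRadical Λ := by
  let I := (arrowIdeal Ω k).image (ψ : GPathAlgebra Ω k →ₙ+* Λ) hψ
  have hI : ∀ y ∈ I, ∃ x ∈ arrowIdeal Ω k, ψ x = y := fun y hy => TwoSidedIdeal.mem_image.1 hy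
  have hnil : IsNilpotentIdeal I := by
    refine ⟨n, (AddSubgroup.eq_bot_iff_forall _).2 fun y hy => ?_⟩
    obtain ⟨z, hz, rfl⟩ := idealPowSucc_le_map (ψ : GPathAlgebra Ω k →ₙ+* Λ) hI n hy
    exact hn z hz
  exact mem_jacobsonRadical_of_mem hnil.isQuasiregularIdeal
    (TwoSidedIdeal.mem_image.2 ⟨x, hx, rfl⟩)

/-- As `ker ψ` lies in the arrow ideal, each component of `toPi` factors through a surjection `q : Λ
→ Ω i`, and `q` must kill the radical because `Ω i` has none. -/
theorem mem_arrowIdeal_of_map_mem_jacobsonRadical (hψ : Function.Surjective ψ)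
    (hJ : ∀ x, ψ x = 0 → x ∈ arrowIdeal Ω k) (hΩ : ∀ i, jacobsonRadical (Ω i) = ⊥)
    {x : GPathAlgebra Ω k} (hx : ψ x ∈ jacobsonRadical Λ) : x ∈ arrowIdeal Ω k := by
  classical
  rw [← toPi_eq_zero_iff]
  ext i
  let p : GPathAlgebra Ω k →ₙ+* Ω i :=
    ((Pi.evalRingHom Ω i : (∀ i, Ω i) →+* Ω i) : (∀ i, Ω i) →ₙ+* Ω i).comp
      (toPi Ω k : GPathAlgebra Ω k →ₙ+* (∀ i, Ω i))
  have hp : ∀ x, p x = toPi Ω k x i := fun x => rfl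
  obtain ⟨q, hq⟩ := exists_comp_eq_of_surjective (f := (ψ : GPathAlgebra Ω k →ₙ+* Λ)) hψ p
    fun y hy => by rw [hp, toPi_eq_zero_iff.2 (hJ y hy)]; rfl
  have hq' : Function.Surjective q := fun a => by
    refine ⟨ψ (ofVertex k i a), (hq _).trans ?_⟩
    rw [hp, toPi_ofVertex, Pi.single_eq_same]
  have h := map_mem_jacobsonRadical hq' hx
  rw [hΩ i, TwoSidedIdeal.mem_bot] at h
  exact (hq x).symm.trans h

theorem canBeLifted_of_surjective (hψ : Function.Surjective ψ)
    (hr : ∀ x, ψ x ∈ jacobsonRadical Λ ↔ x ∈ arrowIdeal Ω k) : CanBeLifted k Λ := by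
  let D := (ψ : GPathAlgebra Ω k →ₗ[k] Λ) ∘ₗ ofVertices Ω k
  have hD : ∀ d, D d = ψ (ofVertices Ω k d) := fun d => rfl
  refine ⟨{ D.range with mul_mem' := ?_ }, ?_, ?_⟩
  · rintro _ _ ⟨d, rfl⟩ ⟨d', rfl⟩
    obtain ⟨d'', h⟩ := exists_eq_ofVertices_mul (k := k) d d'
    exact ⟨d'', by rw [hD, hD, hD, ← map_mul, h]⟩
  · rintro _ ⟨d, rfl⟩ hd
    rw [hD, hr, ← toPi_eq_zero_iff] at hd
    have : d = 0 := DFunLike.ext _ _ fun i => by rw [← toPi_ofVertices (k := k), hd]; rfl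
    rw [this, map_zero]
  · intro y
    obtain ⟨x, rfl⟩ := hψ y
    obtain ⟨d, z, hz, rfl⟩ := exists_eq_ofVertices_add x
    exact ⟨D d, ⟨d, rfl⟩, ψ z, (hr z).2 hz, map_add ψ _ _⟩

theorem isGMUnit_ofVertex_one [∀ i, Nontrivial (Ω i)] (hψ : Function.Surjective ψ)
    (hJ : ∀ x, ψ x = 0 → x ∈ arrowIdeal Ω k) :
    IsGMUnit fun i => ψ (ofVertex k i (1 : Ω i)) where
  idem i := by rw [← map_mul, isIdempotent_ofVertex_one]
  orthogonal i j h := by rw [← map_mul, ofVertex_mul_ofVertex_of_ne h, map_zero]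
  complete y := by
    obtain ⟨x, rfl⟩ := hψ y
    obtain ⟨F, h1, h2⟩ := exists_sum_ofVertex_one_mul x
    exact ⟨F, by rw [← map_sum, ← map_mul, h1], by rw [← map_sum, ← map_mul, h2]⟩
  ne_zero i h := by
    classical
    -- A vertex idempotent killed by `ψ` would lie in the arrow ideal, yet `toPi` shows the entry `1
    -- ≠ 0` there.
    have h1 := toPi_eq_zero_iff.2 (hJ _ h)
    rw [toPi_ofVertex] at h1
    exact one_ne_zero ((Pi.single_eq_same i (1 : Ω i)).symm.trans (congrFun h1 i))

/-- Modulo the arrow ideal everything embeds in `∏ Ω i`, where a vertex idempotent becomes the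
central element `Pi.single i 1`. -/
theorem commutator_ofVertex_one_mem (x : GPathAlgebra Ω k) (i : ι) :
    x * ofVertex k i (1 : Ω i) - ofVertex k i 1 * x ∈ arrowIdeal Ω k := by
  classical
  rw [← toPi_eq_zero_iff, map_sub, map_mul, map_mul, toPi_ofVertex, sub_eq_zero]
  ext j
  by_cases h : j = i
  · subst h; simp
  · simp [Pi.single_eq_of_ne h]

end GPathAlgebra

end Quotient

theorem IsGPathAlgebraWithWeakRelations.exists_gmUnit {k : Type u} [Field k] {Λ : Type v}
    [NonUnitalRing Λ] [Module k Λ] (h : IsGPathAlgebraWithWeakRelations k Λ) :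
    CanBeLifted k Λ ∧ IsNilpotentIdeal (jacobsonRadical Λ) ∧
      ∃ (I : Type v) (_ : Nonempty I) (e : I → Λ), IsGMUnit e ∧
        ∀ i, (e i : (jacobsonRadical Λ).ringCon.Quotient) ∈
          Set.center (jacobsonRadical Λ).ringCon.Quotient := by
  obtain ⟨I, hI, _, Ω, _, _, ρ, _, hΩ, ⟨-, ⟨n, hn⟩, hρ⟩, φ, hφ⟩ := h
  let ψ : GPathAlgebra Ω k →ₙₐ[k] Λ :=
    { toFun := fun x => φ (x : (TwoSidedIdeal.span ρ).ringCon.Quotient)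
      map_smul' := hφ
      map_zero' := map_zero φ
      map_add' := fun x y => map_add φ (x : (TwoSidedIdeal.span ρ).ringCon.Quotient) y
      map_mul' := fun x y => map_mul φ (x : (TwoSidedIdeal.span ρ).ringCon.Quotient) y }
  have hker : ∀ x, ψ x = 0 ↔ x ∈ TwoSidedIdeal.span ρ := fun x => by
    refine (map_eq_zero_iff φ φ.injective).trans ?_
    rw [← RingCon.coe_zero, TwoSidedIdeal.coe_quotient_eq_coe, sub_zero]
  have hψ : Function.Surjective ψ := by
    intro y
    obtain ⟨q, rfl⟩ := φ.surjective y
    induction q using Quotient.inductionOn' with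
    | h x => exact ⟨x, rfl⟩
  have hJ : ∀ x, ψ x = 0 → x ∈ GPathAlgebra.arrowIdeal Ω k := fun x hx => hρ ((hker x).1 hx)
  have hn' : ∀ x ∈ idealPowSucc (GPathAlgebra.arrowIdeal Ω k) n, ψ x = 0 :=
    fun x hx => (hker x).2 (hn x hx)
  -- The radical is the image of the arrow ideal; the complement, nilpotency and centrality are all
  -- read off from this.
  have hr : ∀ x, ψ x ∈ jacobsonRadical Λ ↔ x ∈ GPathAlgebra.arrowIdeal Ω k := fun x =>
    ⟨GPathAlgebra.mem_arrowIdeal_of_map_mem_jacobsonRadical hψ hJ hΩ,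
      GPathAlgebra.map_arrowIdeal_subset_jacobsonRadical hψ hn'⟩
  refine ⟨GPathAlgebra.canBeLifted_of_surjective hψ hr, ⟨n, ?_⟩, I, hI, _,
    GPathAlgebra.isGMUnit_ofVertex_one hψ hJ, fun i => ?_⟩
  · refine (AddSubgroup.eq_bot_iff_forall _).2 fun y hy => ?_
    obtain ⟨x, hx, rfl⟩ := idealPowSucc_le_map (ψ : GPathAlgebra Ω k →ₙ+* Λ)
      (I := GPathAlgebra.arrowIdeal Ω k) (fun y hy => by
        obtain ⟨x, rfl⟩ := hψ y
        exact ⟨x, (hr x).1 hy, rfl⟩) n hy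
    exact hn' x hx
  · refine coe_mem_center_quotient_iff.2 fun y => ?_
    obtain ⟨x, rfl⟩ := hψ y
    rw [← map_mul, ← map_mul, ← map_sub, hr]
    exact GPathAlgebra.commutator_ofVertex_one_mem x i

/-! ### Lifting generalized matrix units -/

section LiftIdempotents

variable {R : Type*} [NonUnitalRing R] {ι : Type*} {f : ι → R}

/-- By `h`, a partial sum fixes `x` up to an error `w * x` with `w ∈ I`. Treating the error in the
same way pushes it into ever higher powers of `I`, hence to zero, and the union of the index sets
used works for `x`. -/
theorem exists_sum_mul_eq_of_isNilpotentIdeal (hi : ∀ i, f i * f i = f i)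
    (ho : ∀ i j, i ≠ j → f i * f j = 0) {I : TwoSidedIdeal R} (hI : IsNilpotentIdeal I)
    (h : ∀ x, ∃ F : Finset ι, ∃ w ∈ I, x = (∑ i ∈ F, f i) * x + w * x) (x : R) :
    ∃ F : Finset ι, (∑ i ∈ F, f i) * x = x := by
  classical
  obtain ⟨n, hn⟩ := hI
  have step : ∀ x, (∀ w ∈ I, ∃ F : Finset ι, (∑ i ∈ F, f i) * (w * x) = w * x) →
      ∃ F : Finset ι, (∑ i ∈ F, f i) * x = x := by
    intro x hx
    obtain ⟨F, w, hw, hF⟩ := h x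
    obtain ⟨G, hG⟩ := hx w hw
    refine ⟨F ∪ G, ?_⟩
    rw [hF, mul_add, sum_mul_eq_of_subset hi ho Finset.subset_union_right hG,
      sum_mul_eq_of_subset hi ho (F := F) Finset.subset_union_left]
    rw [← mul_assoc, Finset.mul_sum]
    exact congrArg (· * x) (Finset.sum_congr rfl fun i h => sum_mul_of_mem hi ho h)
  -- Descending induction on `m`, starting from the vanishing power at `m = n`; `d` is the distance
  -- to it.
  have key : ∀ d m, m + d = n → ∀ x ∈ idealPowSucc I m,
      ∃ F : Finset ι, (∑ i ∈ F, f i) * x = x := by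
    intro d
    induction d with
    | zero =>
      rintro m rfl x hx
      rw [add_zero] at hn
      rw [hn, AddSubgroup.mem_bot] at hx
      exact ⟨∅, by rw [hx, mul_zero]⟩
    | succ d ih =>
      intro m hm x hx
      exact step x fun w hw => ih (m + 1) (by omega) _ (mul_mem_idealPowSucc_succ' hw hx)
  exact step x fun w hw => key n 0 (zero_add n) _
    (mem_idealPowSucc_zero.2 (I.mul_mem_right _ _ hw))

theorem exists_mul_sum_eq_of_isNilpotentIdeal (hi : ∀ i, f i * f i = f i)
    (ho : ∀ i j, i ≠ j → f i * f j = 0) {I : TwoSidedIdeal R} (hI : IsNilpotentIdeal I)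
    (h : ∀ x, ∃ F : Finset ι, ∃ w ∈ I, x = x * (∑ i ∈ F, f i) + x * w) (x : R) :
    ∃ F : Finset ι, x * (∑ i ∈ F, f i) = x := by
  classical
  obtain ⟨n, hn⟩ := hI
  have step : ∀ x, (∀ w ∈ I, ∃ F : Finset ι, x * w * (∑ i ∈ F, f i) = x * w) →
      ∃ F : Finset ι, x * (∑ i ∈ F, f i) = x := by
    intro x hx
    obtain ⟨F, w, hw, hF⟩ := h x
    obtain ⟨G, hG⟩ := hx w hw
    refine ⟨F ∪ G, ?_⟩
    rw [hF, add_mul, mul_sum_eq_of_subset hi ho Finset.subset_union_right hG,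
      mul_sum_eq_of_subset hi ho (F := F) Finset.subset_union_left]
    rw [mul_assoc, Finset.sum_mul]
    exact congrArg (x * ·) (Finset.sum_congr rfl fun i h => mul_sum_of_mem hi ho h)
  have key : ∀ d m, m + d = n → ∀ x ∈ idealPowSucc I m,
      ∃ F : Finset ι, x * (∑ i ∈ F, f i) = x := by
    intro d
    induction d with
    | zero =>
      rintro m rfl x hx
      rw [add_zero] at hn
      rw [hn, AddSubgroup.mem_bot] at hx
      exact ⟨∅, by rw [hx, zero_mul]⟩
    | succ d ih =>
      intro m hm x hx
      exact step x fun w hw => ih (m + 1) (by omega) _ (mul_mem_idealPowSucc_succ hx hw)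
  exact step x fun w hw => key n 0 (zero_add n) _
    (mem_idealPowSucc_zero.2 (I.mul_mem_left _ _ hw))

variable {k : Type*} [Field k] [Module k R]

/-- A generalized matrix unit which is central modulo the nilpotent radical can be replaced by
one inside a complement `A` of the radical, central in `A`. -/
theorem IsGMUnit.exists_mem_complement {e : ι → R} (he : IsGMUnit e)
    (hnil : IsNilpotentIdeal (jacobsonRadical R)) {A : NonUnitalSubalgebra k R}
    (hA : ∀ x ∈ A, x ∈ jacobsonRadical R → x = 0)
    (hA' : ∀ x : R, ∃ a ∈ A, ∃ b ∈ jacobsonRadical R, x = a + b)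
    (hc : ∀ i x, x * e i - e i * x ∈ jacobsonRadical R) :
    ∃ f : ι → R, IsGMUnit f ∧ (∀ i, f i ∈ A) ∧ ∀ a ∈ A, ∀ i, a * f i = f i * a := by
  classical
  -- `f i` and `n i` are the components of `e i` in `A` and in the radical.
  choose f hf n hn hfn using fun i => hA' (e i)
  have hq : ∀ i, (f i : (jacobsonRadical R).ringCon.Quotient) = e i := fun i => by
    rw [TwoSidedIdeal.coe_quotient_eq_coe, hfn i, sub_add_cancel_left]
    exact TwoSidedIdeal.neg_mem _ (hn i)
  -- `A` embeds in the quotient by the radical, so congruences among the `e i` become equalities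
  -- among the `f i`.
  have inj : ∀ a ∈ A, ∀ b ∈ A, (a : (jacobsonRadical R).ringCon.Quotient) = b → a = b :=
    fun a ha b hb h => sub_eq_zero.1
      (hA _ (sub_mem ha hb) (TwoSidedIdeal.coe_quotient_eq_coe.1 h))
  have hi : ∀ i, f i * f i = f i := fun i => by
    refine inj _ (mul_mem (hf i) (hf i)) _ (hf i) ?_
    rw [RingCon.coe_mul, hq, ← RingCon.coe_mul, he.idem]
  have ho : ∀ i j, i ≠ j → f i * f j = 0 := fun i j h => by
    refine inj _ (mul_mem (hf i) (hf j)) _ (zero_mem A) ?_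
    rw [RingCon.coe_mul, hq, hq, ← RingCon.coe_mul, he.orthogonal i j h]
  have hsum : ∀ F : Finset ι, ∑ i ∈ F, e i = ∑ i ∈ F, f i + ∑ i ∈ F, n i := fun F => by
    rw [← Finset.sum_add_distrib]
    exact Finset.sum_congr rfl fun i _ => hfn i
  have hw : ∀ F : Finset ι, ∑ i ∈ F, n i ∈ jacobsonRadical R := fun F =>
    sum_mem fun i _ => hn i
  refine ⟨f, ⟨hi, ho, fun x => ?_, fun i h => ?_⟩, hf, fun a ha i => ?_⟩
  -- The error factor is `∑ i ∈ F, n i`, the difference between the partial sums of `e` and `f`.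
  · obtain ⟨F, hF⟩ := exists_sum_mul_eq_of_isNilpotentIdeal hi ho hnil (fun x => by
      obtain ⟨F, h1, -⟩ := he.complete x
      exact ⟨F, _, hw F, by rw [← add_mul, ← hsum, h1]⟩) x
    obtain ⟨G, hG⟩ := exists_mul_sum_eq_of_isNilpotentIdeal hi ho hnil (fun x => by
      obtain ⟨F, -, h1⟩ := he.complete x
      exact ⟨F, _, hw F, by rw [← mul_add, ← hsum, h1]⟩) x
    exact ⟨F ∪ G, sum_mul_eq_of_subset hi ho Finset.subset_union_left hF,
      mul_sum_eq_of_subset hi ho Finset.subset_union_right hG⟩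
  -- If `f i = 0`, the idempotent `e i = n i` lies in the radical and so vanishes.
  · refine he.ne_zero i (eq_zero_of_isIdempotentElem_of_mem_jacobsonRadical (he.idem i) ?_)
    rw [hfn i, h, zero_add]
    exact hn i
  · refine inj _ (mul_mem ha (hf i)) _ (mul_mem (hf i) ha) ?_
    rw [RingCon.coe_mul, RingCon.coe_mul, hq, ← RingCon.coe_mul, ← RingCon.coe_mul,
      TwoSidedIdeal.coe_quotient_eq_coe]
    exact hc i a

end LiftIdempotents

/-! ### Corners of subalgebras -/

section Corner

variable {k : Type u} [Field k] {Λ : Type v} [NonUnitalRing Λ] [Module k Λ]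
  [IsScalarTower k Λ Λ] [SMulCommClass k Λ Λ]

/-- The subspace of all `a ∈ A` with `f a = a = a f`. -/
def cornerSubmodule (A : NonUnitalSubalgebra k Λ) (f : Λ) : Submodule k Λ where
  carrier := {a | a ∈ A ∧ f * a = a ∧ a * f = a}
  add_mem' := by
    rintro a b ⟨ha, ha1, ha2⟩ ⟨hb, hb1, hb2⟩
    exact ⟨add_mem ha hb, by rw [mul_add, ha1, hb1], by rw [add_mul, ha2, hb2]⟩
  zero_mem' := ⟨zero_mem A, mul_zero f, zero_mul f⟩
  smul_mem' := by
    rintro c a ⟨ha, ha1, ha2⟩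
    exact ⟨SMulMemClass.smul_mem c ha, by rw [mul_smul_comm, ha1], by rw [smul_mul_assoc, ha2]⟩

/-- The corner `f A f` of a subalgebra `A` at an idempotent `f ∈ A`. -/
def SubalgebraCorner (A : NonUnitalSubalgebra k Λ) {f : Λ} (_ : f ∈ A) (_ : f * f = f) : Type v :=
  cornerSubmodule A f

namespace SubalgebraCorner

variable {A : NonUnitalSubalgebra k Λ} {f : Λ} (hA : f ∈ A) (hf : f * f = f)

instance : AddCommGroup (SubalgebraCorner A hA hf) :=
  inferInstanceAs (AddCommGroup (cornerSubmodule A f))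

instance : Module k (SubalgebraCorner A hA hf) :=
  inferInstanceAs (Module k (cornerSubmodule A f))

/-- The inclusion of a corner. -/
def val : SubalgebraCorner A hA hf →ₗ[k] Λ := (cornerSubmodule A f).subtype

theorem val_injective : Function.Injective (val hA hf) := Subtype.val_injective

variable {hA hf} in
theorem val_mem (a : SubalgebraCorner A hA hf) : val hA hf a ∈ A := a.2.1

theorem mul_val (a : SubalgebraCorner A hA hf) : f * val hA hf a = val hA hf a := a.2.2.1

theorem val_mul (a : SubalgebraCorner A hA hf) : val hA hf a * f = val hA hf a := a.2.2.2

theorem exists_val_eq {a : Λ} (ha : a ∈ A) (h1 : f * a = a) (h2 : a * f = a) :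
    ∃ b, val hA hf b = a := ⟨⟨a, ha, h1, h2⟩, rfl⟩

instance : Mul (SubalgebraCorner A hA hf) :=
  ⟨fun a b => ⟨val hA hf a * val hA hf b, mul_mem a.2.1 b.2.1,
    by rw [← mul_assoc, mul_val], by rw [mul_assoc, val_mul]⟩⟩

instance : One (SubalgebraCorner A hA hf) := ⟨⟨f, hA, hf, hf⟩⟩

theorem val_mul_eq (a b : SubalgebraCorner A hA hf) :
    val hA hf (a * b) = val hA hf a * val hA hf b := rfl

theorem val_one : val hA hf 1 = f := rfl

instance : Ring (SubalgebraCorner A hA hf) :=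
  { (inferInstance : AddCommGroup (SubalgebraCorner A hA hf)) with
    mul := (· * ·)
    one := 1
    left_distrib := fun a b c => val_injective hA hf (by
      simp only [val_mul_eq, map_add, mul_add])
    right_distrib := fun a b c => val_injective hA hf (by
      simp only [val_mul_eq, map_add, add_mul])
    zero_mul := fun a => val_injective hA hf (by simp only [val_mul_eq, map_zero, zero_mul])
    mul_zero := fun a => val_injective hA hf (by simp only [val_mul_eq, map_zero, mul_zero])
    mul_assoc := fun a b c => val_injective hA hf (by simp only [val_mul_eq, mul_assoc])
    one_mul := fun a => val_injective hA hf (by rw [val_mul_eq, val_one, mul_val])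
    mul_one := fun a => val_injective hA hf (by rw [val_mul_eq, val_one, val_mul]) }

instance : Algebra k (SubalgebraCorner A hA hf) :=
  Algebra.ofModule
    (fun c a b => val_injective hA hf (by
      simp only [val_mul_eq, map_smul, smul_mul_assoc]))
    (fun c a b => val_injective hA hf (by
      simp only [val_mul_eq, map_smul, mul_smul_comm]))

/-- The inclusion of a corner as a homomorphism of algebras. -/
def valHom : SubalgebraCorner A hA hf →ₙₐ[k] Λ :=
  { val hA hf with
    map_zero' := map_zero (val hA hf)
    map_mul' := val_mul_eq hA hf }

/-- Corners of a complement of the radical at central idempotents have zero radical. -/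
theorem jacobsonRadical_eq_bot (hc : ∀ a ∈ A, a * f = f * a)
    (hr : ∀ x ∈ A, x ∈ jacobsonRadical Λ → x = 0)
    (hr' : ∀ x : Λ, ∃ a ∈ A, ∃ b ∈ jacobsonRadical Λ, x = a + b) :
    jacobsonRadical (SubalgebraCorner A hA hf) = ⊥ := by
  have corner : ∀ a ∈ A, ∃ b, val hA hf b = a * f := fun a ha =>
    exists_val_eq hA hf (mul_mem ha hA) (by rw [← mul_assoc, ← hc a ha, mul_assoc, hf])
      (by rw [mul_assoc, hf])
  -- `K = r(f A f) + r(Λ)`. Modulo `r(Λ)`, an element `b ∈ A` acts on the corner through `b * f`,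
  -- which lies in the corner because `f` is central in `A`; so `K` is an ideal of `Λ`. It turns out
  -- quasi-regular, which forces `r(f A f) ⊆ A ∩ r(Λ) = 0`.
  let K : TwoSidedIdeal Λ := TwoSidedIdeal.mk'
    {x | ∃ a ∈ jacobsonRadical (SubalgebraCorner A hA hf), ∃ n ∈ jacobsonRadical Λ,
      x = val hA hf a + n}
    ⟨0, TwoSidedIdeal.zero_mem _, 0, TwoSidedIdeal.zero_mem _, by simp⟩
    (by
      rintro _ _ ⟨a, ha, n, hn, rfl⟩ ⟨b, hb, m, hm, rfl⟩
      exact ⟨a + b, TwoSidedIdeal.add_mem _ ha hb, n + m, TwoSidedIdeal.add_mem _ hn hm,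
        by rw [map_add]; abel⟩)
    (by
      rintro _ ⟨a, ha, n, hn, rfl⟩
      exact ⟨-a, TwoSidedIdeal.neg_mem _ ha, -n, TwoSidedIdeal.neg_mem _ hn,
        by rw [map_neg]; abel⟩)
    (by
      rintro x _ ⟨a, ha, n, hn, rfl⟩
      obtain ⟨b, hb, m, hm, rfl⟩ := hr' x
      obtain ⟨c, h⟩ := corner b hb
      refine ⟨c * a, TwoSidedIdeal.mul_mem_left _ _ _ ha, m * val hA hf a + (b + m) * n,
        TwoSidedIdeal.add_mem _ (TwoSidedIdeal.mul_mem_right _ _ _ hm)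
          (TwoSidedIdeal.mul_mem_left _ _ _ hn), ?_⟩
      rw [val_mul_eq, h, mul_assoc, mul_val, mul_add, add_mul, add_assoc])
    (by
      rintro _ x ⟨a, ha, n, hn, rfl⟩
      obtain ⟨b, hb, m, hm, rfl⟩ := hr' x
      obtain ⟨c, h⟩ := corner b hb
      refine ⟨a * c, TwoSidedIdeal.mul_mem_right _ _ _ ha, val hA hf a * m + n * (b + m),
        TwoSidedIdeal.add_mem _ (TwoSidedIdeal.mul_mem_left _ _ _ hm)
          (TwoSidedIdeal.mul_mem_right _ _ _ hn), ?_⟩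
      rw [val_mul_eq, h, hc b hb, ← mul_assoc, val_mul, add_mul, mul_add, add_assoc])
  have hK : ∀ x, x ∈ K ↔ ∃ a ∈ jacobsonRadical (SubalgebraCorner A hA hf),
      ∃ n ∈ jacobsonRadical Λ, x = val hA hf a + n :=
    fun x => TwoSidedIdeal.mem_mk' _ _ _ _ _ _ x
  have hKq : IsQuasiregularIdeal K := by
    intro x hx
    obtain ⟨a, ha, n, hn, rfl⟩ := (hK x).1 hx
    -- A quasi-inverse in the corner remains one in `Λ`, and adding an element of a quasi-regular
    -- ideal preserves quasi-regularity.
    exact ((isQuasiregular_of_mem_jacobsonRadical ha).map (valHom hA hf)).add_of_mem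
      isGreatest_jacobsonRadical.1 hn
  refine le_antisymm (TwoSidedIdeal.le_iff.2 fun a ha => ?_) bot_le
  refine (TwoSidedIdeal.mem_bot _).2 (val_injective hA hf ?_)
  rw [map_zero]
  exact hr _ (val_mem a) (mem_jacobsonRadical_of_mem hKq
    ((hK _).2 ⟨a, ha, 0, TwoSidedIdeal.zero_mem _, (add_zero _).symm⟩))

end SubalgebraCorner

end Corner

/-! ### Presenting an algebra by generalized paths -/

section Presentation

variable {k : Type u} [Field k] {Λ : Type v} [NonUnitalRing Λ] [Module k Λ]

theorem isGPathAlgebraWithWeakRelations_of_surjective {I : Type v} [hI : Nonempty I]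
    [Q : Quiver.{v} I] {Ω : I → Type v} [R : ∀ i, Ring (Ω i)] [S : ∀ i, Algebra k (Ω i)]
    (hΩ : ∀ i, Nontrivial (Ω i)) (hr : ∀ i, jacobsonRadical (Ω i) = ⊥)
    (ψ : GPathAlgebra Ω k →ₙₐ[k] Λ) (hψ : Function.Surjective ψ)
    (hJ : ∀ x, ψ x = 0 → x ∈ GPathAlgebra.arrowIdeal Ω k) {n : ℕ}
    (hn : ∀ x ∈ idealPowSucc (GPathAlgebra.arrowIdeal Ω k) n, ψ x = 0) :
    IsGPathAlgebraWithWeakRelations k Λ := by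
  -- The whole kernel is the relation set; it is non-empty since it contains `0`.
  let ρ : Set (GPathAlgebra Ω k) := {x | ψ x = 0}
  have hρ : ∀ x, ψ x = 0 ↔ x ∈ TwoSidedIdeal.span ρ := fun x => by
    refine ⟨fun h => TwoSidedIdeal.subset_span h, fun h => ?_⟩
    have hle : TwoSidedIdeal.span ρ ≤ TwoSidedIdeal.ker ψ :=
      TwoSidedIdeal.span_le.2 fun y hy => (TwoSidedIdeal.mem_ker ψ).2 hy
    exact (TwoSidedIdeal.mem_ker ψ).1 (hle h)
  obtain ⟨φ, hφ⟩ := TwoSidedIdeal.exists_quotient_equiv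
    (f := (ψ : GPathAlgebra Ω k →ₙ+* Λ)) hψ hρ
  refine ⟨I, hI, Q, Ω, R, S, ρ, hΩ, hr, ⟨⟨0, map_zero ψ⟩, ⟨n, fun x hx => (hρ x).1 (hn x hx)⟩,
    TwoSidedIdeal.le_iff.2 fun x hx => hJ x ((hρ x).2 hx)⟩, φ, fun c x => ?_⟩
  rw [hφ, hφ]
  exact map_smul ψ c x

theorem isGPathAlgebraWithWeakRelations_of_gmUnit_mem_complement
    [IsScalarTower k Λ Λ] [SMulCommClass k Λ Λ]
    {A : NonUnitalSubalgebra k Λ} (hA : ∀ x ∈ A, x ∈ jacobsonRadical Λ → x = 0)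
    (hA' : ∀ x : Λ, ∃ a ∈ A, ∃ b ∈ jacobsonRadical Λ, x = a + b)
    (hnil : IsNilpotentIdeal (jacobsonRadical Λ)) {I : Type v} [Nonempty I] {f : I → Λ}
    (hf : IsGMUnit f) (hfA : ∀ i, f i ∈ A) (hc : ∀ a ∈ A, ∀ i, a * f i = f i * a) :
    IsGPathAlgebraWithWeakRelations k Λ := by
  classical
  -- Every element of `f i r(Λ) f j`, even `0`, is an arrow; the redundancy is absorbed by the
  -- relations.
  let _ : Quiver.{v} I := ⟨fun i j => {x : Λ // x ∈ jacobsonRadical Λ ∧ f i * x = x ∧ x * f j = x}⟩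
  let Ω : I → Type v := fun i => SubalgebraCorner A (hfA i) (hf.idem i)
  let φ : ∀ i, Ω i →ₙₐ[k] Λ := fun i => SubalgebraCorner.valHom (hfA i) (hf.idem i)
  have hφ1 : ∀ i, φ i 1 = f i := fun i => rfl
  have hφf : ∀ i a, f i * φ i a = φ i a := fun i a =>
    SubalgebraCorner.mul_val (hfA i) (hf.idem i) a
  have hφinj : ∀ i, Function.Injective (φ i) := fun i =>
    SubalgebraCorner.val_injective (hfA i) (hf.idem i)
  have hφA : ∀ i a, φ i a ∈ A := fun i a => SubalgebraCorner.val_mem a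
  let g : ∀ {i j : I}, (i ⟶ j) → Λ := fun x => x.1
  have ho : ∀ i j, i ≠ j → φ i 1 * φ j 1 = 0 := hf.orthogonal
  let ψ : GPathAlgebra Ω k →ₙₐ[k] Λ := GPathAlgebra.lift φ g ho
  have hψv : ∀ i a, ψ (GPathAlgebra.ofVertex k i a) = φ i a := fun i a =>
    (GPathAlgebra.lift_ofPath φ g ho _).trans (by simp only [GPath.eval])
  have hψa : ∀ {i j : I} (x : i ⟶ j), ψ (GPathAlgebra.arrow k x) = x.1 := fun {i j} x => by
    refine (GPathAlgebra.lift_arrow φ g ho x).trans ?_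
    rw [hφ1, hφ1]
    change f i * x.1 * f j = x.1
    rw [x.2.2.1, x.2.2.2]
  have hψJ : ∀ x ∈ GPathAlgebra.arrowIdeal Ω k, ψ x ∈ jacobsonRadical Λ := by
    have h : GPathAlgebra.arrowIdeal Ω k ≤ TwoSidedIdeal.comap ψ (jacobsonRadical Λ) := by
      refine TwoSidedIdeal.span_le.2 ?_
      rintro _ ⟨i, j, x, rfl⟩
      refine (TwoSidedIdeal.mem_comap ψ).2 ?_
      rw [hψa]
      exact x.2.1
    exact fun x hx => (TwoSidedIdeal.mem_comap ψ).1 (h hx)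
  -- Multiplication by `f i` extracts the `i`-th component, so `ψ` is injective on the vertex part,
  -- with values in `A`.
  have hψD : ∀ d : ⨁ i, Ω i, ψ (GPathAlgebra.ofVertices Ω k d) ∈ A ∧
      ∀ i, f i * ψ (GPathAlgebra.ofVertices Ω k d) = φ i (d i) := by
    intro d
    induction d using DirectSum.induction_on with
    | zero => simp
    | add d e hd he =>
      rw [map_add, map_add]
      refine ⟨add_mem hd.1 he.1, fun i => ?_⟩
      rw [mul_add, hd.2, he.2, DirectSum.add_apply, map_add]
    | of j a =>
      rw [GPathAlgebra.ofVertices_of, hψv]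
      refine ⟨hφA j a, fun i => ?_⟩
      by_cases h : i = j
      · subst h
        rw [DirectSum.of_eq_same, hφf]
      · rw [DirectSum.of_eq_of_ne _ _ _ h, map_zero, ← hφf, ← mul_assoc, hf.orthogonal i j h,
          zero_mul]
  have hsurj : Function.Surjective ψ := by
    have hsub : ∀ x, x ∈ (ψ : GPathAlgebra Ω k →+ Λ).range ↔ ∃ y, ψ y = x := fun x => Iff.rfl
    intro x
    rw [← hsub]
    obtain ⟨a, ha, b, hb, rfl⟩ := hA' x
    refine add_mem ?_ ?_
    -- `a` is a sum of the `f i * a`, each in a corner since `f i` is central in `A`.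
    · obtain ⟨F, h, -⟩ := hf.complete a
      rw [← h, Finset.sum_mul]
      refine sum_mem fun i _ => (hsub _).2 ?_
      obtain ⟨c, hc'⟩ := SubalgebraCorner.exists_val_eq (hfA i) (hf.idem i)
        (mul_mem (hfA i) ha) (by rw [← mul_assoc, hf.idem])
        (by rw [← hc a ha, mul_assoc, hf.idem])
      exact ⟨_, (hψv i c).trans hc'⟩
    -- `b` is a sum of the Peirce components `f i * b * f j`, each of which is itself an arrow.
    · obtain ⟨F, h1, h2⟩ := hf.complete b
      rw [← h2, ← h1, Finset.sum_mul, Finset.sum_mul]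
      refine sum_mem fun i _ => ?_
      rw [Finset.mul_sum]
      refine sum_mem fun j _ => (hsub _).2 ?_
      let y : i ⟶ j := ⟨f i * b * f j, TwoSidedIdeal.mul_mem_right _ _ _
        (TwoSidedIdeal.mul_mem_left _ _ _ hb), by rw [← mul_assoc, ← mul_assoc, hf.idem],
        by rw [mul_assoc, hf.idem]⟩
      exact ⟨_, hψa y⟩
  obtain ⟨n, hn⟩ := hnil
  refine isGPathAlgebraWithWeakRelations_of_surjective (fun i => ?_)
    (fun i => SubalgebraCorner.jacobsonRadical_eq_bot (hfA i) (hf.idem i)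
      (fun a ha => hc a ha i) hA hA') ψ hsurj (fun x hx => ?_) (n := n) fun x hx => ?_
  · refine ⟨⟨1, 0, fun h => hf.ne_zero i ?_⟩⟩
    rw [← hφ1, h, map_zero]
  · obtain ⟨d, y, hy, rfl⟩ := GPathAlgebra.exists_eq_ofVertices_add x
    rw [map_add] at hx
    -- For `x` in the kernel, the value of the vertex part is minus that of the arrow part, so it
    -- lies in `A ∩ r(Λ) = 0`.
    have hd : ψ (GPathAlgebra.ofVertices Ω k d) = 0 := by
      refine hA _ (hψD d).1 ?_
      rw [eq_neg_of_add_eq_zero_left hx]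
      exact TwoSidedIdeal.neg_mem _ (hψJ y hy)
    have hd' : d = 0 := DFunLike.ext _ _ fun i => hφinj i (by
      rw [← (hψD d).2, hd, mul_zero, DirectSum.zero_apply, map_zero])
    rwa [hd', map_zero, zero_add]
  · have h := map_mem_idealPowSucc (ψ : GPathAlgebra Ω k →ₙ+* Λ) hψJ hx
    rwa [hn, AddSubgroup.mem_bot] at h

end Presentation

theorem theorem3p8 (k : Type u) [Field k] (Λ : Type v) [NonUnitalRing Λ] [Module k Λ]
    [IsScalarTower k Λ Λ] [SMulCommClass k Λ Λ] :
    (CanBeLifted k Λ ∧ IsNilpotentIdeal (jacobsonRadical Λ) ∧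
      ∃ (I : Type v) (_ : Nonempty I) (e : I → Λ), IsGMUnit e ∧
        ∀ i, (e i : (jacobsonRadical Λ).ringCon.Quotient) ∈
          Set.center (jacobsonRadical Λ).ringCon.Quotient) ↔
      IsGPathAlgebraWithWeakRelations k Λ := by
  refine ⟨?_, IsGPathAlgebraWithWeakRelations.exists_gmUnit⟩
  rintro ⟨⟨A, hA, hA'⟩, hnil, I, hI, e, he, hc⟩
  obtain ⟨f, hf, hfA, hfc⟩ := he.exists_mem_complement hnil hA hA'
    fun i => coe_mem_center_quotient_iff.1 (hc i)
  exact isGPathAlgebraWithWeakRelations_of_gmUnit_mem_complement hA hA' hnil hf hfA hfc
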